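/- **Setting.** Let $p,q,N\ge 1$, $0\le r\le p-1$ and $M:=Np-r$. Let $\mathrm d\mu=(\mathrm d\mu_{b,a})$ be a $q\times p$ matrix of (complex) measures on $\mathbb R$ with finite moments of all orders, and let $\Delta$ be the union of the supports of its entries. Let $R(x)=\sum_{l=0}^N R_lx^l$, $R_l\in\mathbb C^{p\times p}$, be normalized by $$R_N=\begin{bmatrix}0_{(p-r)\times r}&I_{p-r}\\0_{r\times r}&0_{r\times(p-r)}\end{bmatrix},\qquad R_{N-1}=\begin{bmatrix}*&*\\ I_r&*\end{bmatrix}$$ (same block sizes), so that $\deg\det R=M$. Assume that $\det R$ has $M$ distinct (hence simple) zeros $x_1,\dots,x_M\in\mathbb C\setminus\Delta$, and let $\boldsymbol v_i^L$ (row) and $\boldsymbol v_i^R$ (column) be nonzero vectors with $\boldsymbol v_i^LR(x_i)=0$, $R(x_i)\boldsymbol v_i^R=0$. For columns $\boldsymbol\xi_i\in\mathbb C^q$ let $$\mathrm d\check\mu=\mathrm d\mu\,R^{-1}+\sum_{i=1}^M\boldsymbol\xi_i\boldsymbol v_i^L\,\delta_{x_i},\qquad\text{so that } \mathrm d\check\mu\,R=\mathrm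 d\mu .$$ With $X_{[s]}(x)=[I_s,\,xI_s,\,x^2I_s,\dots]^\top$, the moment matrix of $\mu$ is $\mathscr M=\int X_{[q]}\,\mathrm d\mu\,X_{[p]}^\top$, and that of $\check\mu$ is $\check{\mathscr M}$, defined in the same way. Assume that both orthogonalities exist, i.e. that there are factorizations $\mathscr M=S^{-1}H\bar S^{-\top}$ and $\check{\mathscr M}=\check S^{-1}\check H\check{\bar S}^{-\top}$ with $S,\bar S,\check S,\check{\bar S}$ lower unitriangular and $H,\check H$ diagonal and invertible. Rows and columns of semi-infinite matrices are numbered from $0$. Let $B=SX_{[q]}$, with rows $B_n=(B_n^{(1)},\dots,B_n^{(q)})$, and $A=X_{[p]}^\top\bar S^\top H^{-1}$, with columns $A_n=(A_n^{(1)},\dots,A_n^{(p)})^\top$; define $\check B,\check A$ likewise from $\check S,\check{\bar S},\check H$. Let $\Omega=\check SS^{-1}$ be the connection matrix. Put $$D_n(z)=\int B_n(t)\frac{\mathrm d\mu(t)}{z-t},\quad K^{[n]}(x,y)=\sum_{k=0}^nA_k(x)B_k(y),\quad K_D^{[n]}(x,y)=\sum_{k=0}^nA_k(x)D_k(y),$$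 $$g_n^{(i)}=\mathbb D_n^{(i)}-\mathbb W_n^{(i)}:=D_n(x_i)\boldsymbol v_i^R-B_n(x_i)\boldsymbol\xi_i\,\boldsymbol v_i^LR'(x_i)\boldsymbol v_i^R,\qquad g_n=(g_n^{(1)},\dots,g_n^{(M)}),$$ $$\mathbb K^{[n],(i)}(x)=K_D^{[n]}(x,x_i)\boldsymbol v_i^R-K^{[n]}(x,x_i)\boldsymbol\xi_i\,\boldsymbol v_i^LR'(x_i)\boldsymbol v_i^R .$$ For $n\ge M-1$ let $\tau_n$ be the determinant of the $M\times M$ matrix with rows $g_{n-M+1},\dots,g_n$. For $n\ge M$ and $0\le j\le M$ let $\tau_n^{(j)}$ be the determinant of the $M\times M$ matrix with rows $g_{n-M},\dots,g_n$, the row $g_{n-j}$ being omitted; thus $\tau_n=\tau_n^{(M)}$ and $\tau_{n-1}=\tau_n^{(0)}$ for $n\ge M$. **Theorem.** $\tau_n\neq0$ for all $n\ge M-1$, and for every $n\ge M$: 1. $\displaystyle\Omega_{n,n-M}=(-1)^M\frac{\tau_n}{\tau_{n-1}}$ and $\displaystyle\Omega_{n,n-j}=(-1)^j\frac{\tau_n^{(j)}}{\tau_{n-1}}$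 for $0\le j\le M$. 2. For $1\le a\le p$ and $x\in\mathbb C\setminus\{x_1,\dots,x_M\}$, $$\check A_n^{(a)}(x)=-\sum_{\tilde a=1}^p\frac{R_{a,\tilde a}(x)}{\tau_n}\begin{vmatrix}g^{(1)}_{n-M+1}&\cdots&g^{(M)}_{n-M+1}\\ \vdots&&\vdots\\ g^{(1)}_{n-1}&\cdots&g^{(M)}_{n-1}\\ \mathbb K^{[n-M],(1)}_{\tilde a}(x)+\frac{v^R_{1;\tilde a}}{x-x_1}&\cdots&\mathbb K^{[n-M],(M)}_{\tilde a}(x)+\frac{v^R_{M;\tilde a}}{x-x_M}\end{vmatrix}.$$ 3. For $1\le b\le q$ and $x\in\mathbb C$, $$\check B_n^{(b)}(x)=\frac1{\tau_{n-1}}\begin{vmatrix}g^{(1)}_{n-M}&\cdots&g^{(M)}_{n-M}&B^{(b)}_{n-M}(x)\\ \vdots&&\vdots&\vdots\\ g^{(1)}_{n}&\cdots&g^{(M)}_{n}&B^{(b)}_{n}(x)\end{vmatrix}.$$ -/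

import Mathlib

open MeasureTheory

noncomputable section

namespace MixedMOP

variable {p q M : ℕ}

/-! ### Matrices of measures and their moments -/

/-- Integration against each entry of a `q × p` matrix of (complex) measures or of distributions of
order zero: the entry `(b, a)` sends a function `f` of a complex variable to `∫ f dμ_{b,a}`. -/
abbrev MatrixFunctional (q p : ℕ) : Type :=
  Matrix (Fin q) (Fin p) ((ℂ → ℂ) → ℂ)

/-- The matrix functional `f ↦ ∫ f dμ` of a matrix `μ` of complex measures on the real line. -/
def integ (μ : Matrix (Fin q) (Fin p) (ComplexMeasure ℝ)) : MatrixFunctional q p :=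
  fun b a f => ∫ᵛ t : ℝ, f (t : ℂ) ∂[ContinuousLinearMap.mul ℝ ℂ; μ b a]

/-- The support `Δ` of a matrix of measures: the union of the (closed) supports of the total
variations of its entries. -/
def supp (μ : Matrix (Fin q) (Fin p) (ComplexMeasure ℝ)) : Set ℝ :=
  ⋃ b, ⋃ a, (μ b a).variation.support

/-- The semi-infinite moment matrix `∫ X_{[q]}(x) dμ(x) X_{[p]}(x)ᵀ`, where `X_{[r]}(x)` is the
column of blocks `I_r, x I_r, x² I_r, …`.  Counting from `0`, row `i` carries the monomial
`x ^ (i / q)` in the position `i % q`, and column `j` the monomial `x ^ (j / p)` in the position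
`j % p`. -/
def momentMatrix [NeZero p] [NeZero q] (L : MatrixFunctional q p) : Matrix ℕ ℕ ℂ :=
  fun i j => L (Fin.ofNat q i) (Fin.ofNat p j) fun z => z ^ (i / q + j / p)

/-! ### Gauss--Borel factorization and mixed multiple orthogonal polynomials -/

/-- Lower unitriangular semi-infinite matrices. -/
structure LowerUnitriangular (S : Matrix ℕ ℕ ℂ) : Prop where
  upper : ∀ i j, i < j → S i j = 0
  diag : ∀ i, S i i = 1

/-- The Gauss--Borel (`LU`) factorization `𝓜 = S⁻¹ H S̄⁻ᵀ`, with `S`, `S̄` lower unitriangular and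
`H` diagonal and invertible, written in the form `S 𝓜 S̄ᵀ = H`, in which all sums are finite. -/
structure GaussBorel (𝓜 S Sbar : Matrix ℕ ℕ ℂ) (H : ℕ → ℂ) : Prop where
  left : LowerUnitriangular S
  right : LowerUnitriangular Sbar
  diag_ne_zero : ∀ n, H n ≠ 0
  factor : ∀ n m, ∑ i ∈ Finset.range (n + 1), ∑ j ∈ Finset.range (m + 1),
    S n i * 𝓜 i j * Sbar m j = if n = m then H n else 0

/-- The entries `B_n^{(b)}` of `B(x) = S X_{[q]}(x)`. -/
def polyB (S : Matrix ℕ ℕ ℂ) (n : ℕ) (b : Fin q) : Polynomial ℂ :=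
  ∑ i ∈ Finset.range (n + 1) with i % q = b, Polynomial.monomial (i / q) (S n i)

/-- The entries `A_n^{(a)}` of `A(x) = X_{[p]}(x)ᵀ S̄ᵀ H⁻¹`. -/
def polyA (Sbar : Matrix ℕ ℕ ℂ) (H : ℕ → ℂ) (n : ℕ) (a : Fin p) : Polynomial ℂ :=
  ∑ j ∈ Finset.range (n + 1) with j % p = a, Polynomial.monomial (j / p) (Sbar n j / H n)

/-- The inverse of a lower unitriangular semi-infinite matrix.  Its row `i` is the last row of the
inverse of the leading principal submatrix with rows and columns `0, …, i`, followed by zeros. -/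
def triInv (S : Matrix ℕ ℕ ℂ) : Matrix ℕ ℕ ℂ :=
  fun i j => if h : j ≤ i then
    (Matrix.of fun k l : Fin (i + 1) => S k l)⁻¹ (Fin.last i) ⟨j, Nat.lt_succ_of_le h⟩ else 0

/-- The connection matrix `Ω = Š S⁻¹` of two lower unitriangular matrices. -/
def connection (Sc S : Matrix ℕ ℕ ℂ) : Matrix ℕ ℕ ℂ :=
  fun n m => ∑ k ∈ Finset.range (n + 1), Sc n k * triInv S k m

/-- The Cauchy transforms `D_n^{(a)}(z)`, the entries of `D(z) = ∫ B(t) dμ(t) / (z - t)`. -/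
def cauchyD (μ : Matrix (Fin q) (Fin p) (ComplexMeasure ℝ)) (S : Matrix ℕ ℕ ℂ)
    (n : ℕ) (z : ℂ) (a : Fin p) : ℂ :=
  ∑ b, integ μ b a fun t => (polyB S n b).eval t / (z - t)

/-- The Christoffel--Darboux kernel `K^{[n]}(x, y) = ∑_{i=0}^n A_i(x) B_i(y)`. -/
def kernel (S Sbar : Matrix ℕ ℕ ℂ) (H : ℕ → ℂ) (n : ℕ) (x y : ℂ) : Matrix (Fin p) (Fin q) ℂ :=
  fun a b => ∑ i ∈ Finset.range (n + 1), (polyA Sbar H i a).eval x * (polyB S i b).eval y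

/-- The mixed Christoffel--Darboux kernel `K_D^{[n]}(x, y) = ∑_{i=0}^n A_i(x) D_i(y)`. -/
def kernelD (μ : Matrix (Fin q) (Fin p) (ComplexMeasure ℝ)) (S Sbar : Matrix ℕ ℕ ℂ) (H : ℕ → ℂ)
    (n : ℕ) (x y : ℂ) : Matrix (Fin p) (Fin p) ℂ :=
  fun a c => ∑ i ∈ Finset.range (n + 1), (polyA Sbar H i a).eval x * cauchyD μ S i y c

/-! ### Geronimus perturbations -/

/-- The value `R(z)` of a matrix polynomial. -/
def evalMat (R : Matrix (Fin p) (Fin p) (Polynomial ℂ)) (z : ℂ) : Matrix (Fin p) (Fin p) ℂ :=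
  R.map (Polynomial.eval z)

/-- `R` is a matrix polynomial `∑_{l=0}^N R_l x^l` whose leading and subleading coefficients are
`R_N = [0, I_{p-r}; 0, 0]` (with blocks of `p - r` and `r` rows, `r` and `p - r` columns) and
`R_{N-1} = [*, *; I_r, *]`. -/
structure IsNormalized (R : Matrix (Fin p) (Fin p) (Polynomial ℂ)) (N r : ℕ) : Prop where
  degree : ∀ a c l, N < l → (R a c).coeff l = 0
  leading : ∀ a c : Fin p, (R a c).coeff N = if (c : ℕ) = a + r then 1 else 0
  subleading : ∀ a c : Fin p, p - r ≤ (a : ℕ) → (c : ℕ) < r →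
    (R a c).coeff (N - 1) = if (a : ℕ) = (p - r) + c then 1 else 0

/-- The data of a Geronimus perturbation with `M` point masses. -/
structure GeronimusData (p q M : ℕ) where
  /-- the perturbing matrix polynomial -/
  R : Matrix (Fin p) (Fin p) (Polynomial ℂ)
  /-- its eigenvalues `x_i`, at which the masses are placed -/
  x : Fin M → ℂ
  /-- the left (row) eigenvectors -/
  vL : Fin M → Fin p → ℂ
  /-- the right (column) eigenvectors -/
  vR : Fin M → Fin p → ℂ
  /-- the masses: the columns `ξ_i = ξ_i(x_i)` -/
  ξ : Fin M → Fin q → ℂ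

namespace GeronimusData

variable (G : GeronimusData p q M)

/-- The eigenvalues `x_i` are pairwise distinct zeros of `det R`, and `v_i^L R(x_i) = 0`,
`R(x_i) v_i^R = 0` with nonzero vectors. -/
structure IsSpectral : Prop where
  injective : Function.Injective G.x
  isRoot : ∀ i, G.R.det.IsRoot (G.x i)
  left_ne_zero : ∀ i, G.vL i ≠ 0
  left_eigen : ∀ i, Matrix.vecMul (G.vL i) (evalMat G.R (G.x i)) = 0
  right_ne_zero : ∀ i, G.vR i ≠ 0
  right_eigen : ∀ i, Matrix.mulVec (evalMat G.R (G.x i)) (G.vR i) = 0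

/-- The perturbed matrix of measures `μ̌ = μ R⁻¹ + ∑_i ξ_i v_i^L δ_{x_i}`, a solution of
`dμ̌ R = dμ`, as the functional of integration against it. -/
def perturbed (μ : Matrix (Fin q) (Fin p) (ComplexMeasure ℝ)) : MatrixFunctional q p :=
  fun b a f =>
    (∑ c, integ μ b c fun t => f t * (evalMat G.R t)⁻¹ c a)
      + ∑ i, G.ξ i b * G.vL i a * f (G.x i)

/-- The scalar `v_i^L R'(x_i) v_i^R`. -/
def residue (i : Fin M) : ℂ :=
  G.vL i ⬝ᵥ Matrix.mulVec (evalMat (G.R.map Polynomial.derivative) (G.x i)) (G.vR i)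

/-- `𝔻_n^{(i)} = ∑_a D_n^{(a)}(x_i) v_{i;a}^R`. -/
def DD (μ : Matrix (Fin q) (Fin p) (ComplexMeasure ℝ)) (S : Matrix ℕ ℕ ℂ) (n : ℕ) (i : Fin M) : ℂ :=
  ∑ a, cauchyD μ S n (G.x i) a * G.vR i a

/-- `𝕎_n^{(i)} = ∑_b B_n^{(b)}(x_i) ξ_{i;b} v_i^L R'(x_i) v_i^R`. -/
def WW (S : Matrix ℕ ℕ ℂ) (n : ℕ) (i : Fin M) : ℂ :=
  ∑ b, (polyB S n b).eval (G.x i) * G.ξ i b * G.residue i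

/-- The difference `𝔻_n^{(i)} - 𝕎_n^{(i)}`. -/
def DW (μ : Matrix (Fin q) (Fin p) (ComplexMeasure ℝ)) (S : Matrix ℕ ℕ ℂ) (n : ℕ) (i : Fin M) : ℂ :=
  G.DD μ S n i - G.WW S n i

/-- The vector polynomial
`𝕂^{[n],(i)}(x) = K_D^{[n]}(x, x_i) v_i^R - K^{[n]}(x, x_i) ξ_i v_i^L R'(x_i) v_i^R`. -/
def KK (μ : Matrix (Fin q) (Fin p) (ComplexMeasure ℝ)) (S Sbar : Matrix ℕ ℕ ℂ) (H : ℕ → ℂ)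
    (n : ℕ) (i : Fin M) (x : ℂ) : Fin p → ℂ :=
  Matrix.mulVec (kernelD μ S Sbar H n x (G.x i)) (G.vR i)
    - G.residue i • Matrix.mulVec (kernel S Sbar H n x (G.x i)) (G.ξ i)

/-- `τ_n^{(j)}`, `0 ≤ j ≤ M ≤ n`: the determinant of the `M × M` matrix whose rows are
`(𝔻_k^{(1)} - 𝕎_k^{(1)}, …, 𝔻_k^{(M)} - 𝕎_k^{(M)})` for `k = n - M, …, n` with `k = n - j` omitted
(`Fin.rev j` has the value `M - j`). -/
def tauMinor (μ : Matrix (Fin q) (Fin p) (ComplexMeasure ℝ)) (S : Matrix ℕ ℕ ℂ)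
    (n : ℕ) (j : Fin (M + 1)) : ℂ :=
  (Matrix.of fun k i : Fin M => G.DW μ S (n - M + ((Fin.rev j).succAbove k : ℕ)) i).det

/-- `τ_n`, `n ≥ M - 1`: the determinant with the rows `k = n - M + 1, …, n`. -/
def tau (μ : Matrix (Fin q) (Fin p) (ComplexMeasure ℝ)) (S : Matrix ℕ ℕ ℂ) (n : ℕ) : ℂ :=
  (Matrix.of fun k i : Fin M => G.DW μ S (n + 1 - M + k) i).det

/-- The determinant in the formula for `Ǎ_n`, `n ≥ M`: the rows
`𝔻_k - 𝕎_k` for `k = n - M + 1, …, n - 1`, and the last row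
`𝕂_c^{[n-M],(i)}(x) + v_{i;c}^R / (x - x_i)`. -/
def detA (μ : Matrix (Fin q) (Fin p) (ComplexMeasure ℝ)) (S Sbar : Matrix ℕ ℕ ℂ) (H : ℕ → ℂ)
    (n : ℕ) (c : Fin p) (x : ℂ) : ℂ :=
  (Matrix.of fun k i : Fin M =>
    if (k : ℕ) + 1 < M then G.DW μ S (n - M + 1 + k) i
    else G.KK μ S Sbar H (n - M) i x c + G.vR i c / (x - G.x i)).det

/-- The determinant in the formula for `B̌_n`, `n ≥ M`: the rows
`(𝔻_k^{(1)} - 𝕎_k^{(1)}, …, 𝔻_k^{(M)} - 𝕎_k^{(M)}, B_k^{(b)}(x))` for `k = n - M, …, n`. -/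
def detB (μ : Matrix (Fin q) (Fin p) (ComplexMeasure ℝ)) (S : Matrix ℕ ℕ ℂ)
    (n : ℕ) (b : Fin q) (x : ℂ) : ℂ :=
  (Matrix.of fun k : Fin (M + 1) =>
    (Fin.snoc (fun i : Fin M => G.DW μ S (n - M + k) i) ((polyB S (n - M + k) b).eval x) :
      Fin (M + 1) → ℂ)).det

end GeronimusData

end MixedMOP

end

noncomputable section

namespace MixedMOP

variable {p q M : ℕ}

section

/-! ### Integration of rational functions -/

/-! Integration enters only through two bilinear forms on polynomial vectors: ⟨f, g⟩ for `μ` and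
β(f, g) for the perturbed measure, tied by β(f, R g) = ⟨f, g⟩. The zeros of det R are exactly the
`x_i`, hence off the support, so both forms are built from the functionals P ↦ ∫ P dμ / det R. Each
Gauss–Borel factorization says that the B's and A's are biorthonormal, and the A's are graded by the
monomial basis e_1, …, e_p, x e_1, ….

The normalization of R makes g ↦ R g raise this grading by exactly M, with leading factor 1. Since
Ω_{n,k} = β(B̌_n, R A_k), Ω vanishes for k < n - M and its entry at k = n - M is nonzero. The second
ingredient is the polynomial vectors E_i = R v_i^R / (x - x_i), of degree below M in the grading,
with β(B_n, E_i) = -g_n^{(i)} (`DW_eq`). For n ≥ M, orthogonality gives β(B̌_n, E_i) = 0, that is,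
∑_k Ω_{n,k} g_k^{(i)} = 0. With Ω_{n,n} = 1 these M equations determine row n of Ω; Cramer's rule
yields the formulas for Ω and B̌.

τ_n ≠ 0: a kernel vector c makes ∑_i c_i g_k^{(i)} vanish for M consecutive k. The nonzero extreme
entries of Ω propagate this down to k = 0, so ∑ c_i E_i is orthogonal to every B̌_m with m < M and
is therefore zero; the E_i are linearly independent.

For Ǎ, expand R A_k and E_i in the Ǎ_m. In R (𝕂^{[n-M],(i)} + v_i^R / (x - x_i)) the terms with k ≤
n - M cancel, leaving a combination of the rows g_{n-M+1}, …, g_n in which g_n has coefficient -Ǎ_n;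
the determinant sees only that coefficient. -/

open Polynomial in
-- Each root lies in the open complement of the closed set, hence at positive distance from it;
-- factoring the polynomial multiplies these distances. This makes P / d integrable whenever all
-- moments are finite.
lemma exists_le_norm_eval {Δ : Set ℝ} (hΔ : IsClosed Δ) {d : ℂ[X]}
    (hd : ∀ t ∈ Δ, d.eval (t : ℂ) ≠ 0) : ∃ ε > 0, ∀ t ∈ Δ, ε ≤ ‖d.eval (t : ℂ)‖ := by
  rcases eq_or_ne d 0 with rfl | h0
  · exact ⟨1, one_pos, fun t ht => absurd eval_zero (hd t ht)⟩
  have key : ∀ s : Multiset ℂ, (∀ r ∈ s, ∀ t ∈ Δ, (t : ℂ) ≠ r) →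
      ∃ ε > 0, ∀ t ∈ Δ, ε ≤ ‖(s.map fun r => (t : ℂ) - r).prod‖ := by
    intro s
    induction s using Multiset.induction_on with
    | empty => exact fun _ => ⟨1, one_pos, fun t _ => by simp⟩
    | cons r s ih =>
      intro h
      obtain ⟨ε, hε, h1⟩ := ih fun r' hr' => h r' (Multiset.mem_cons_of_mem hr')
      have hcl : IsClosed ((fun t : ℝ => (t : ℂ)) '' Δ) :=
        Complex.isometry_ofReal.isClosedEmbedding.isClosedMap _ hΔ
      have hr : r ∈ ((fun t : ℝ => (t : ℂ)) '' Δ)ᶜ := by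
        rintro ⟨t, ht, e⟩
        exact h r (Multiset.mem_cons_self r s) t ht e
      obtain ⟨δ, hδ, hball⟩ := Metric.isOpen_iff.1 hcl.isOpen_compl r hr
      refine ⟨δ * ε, mul_pos hδ hε, fun t ht => ?_⟩
      rw [Multiset.map_cons, Multiset.prod_cons, norm_mul]
      refine mul_le_mul ?_ (h1 t ht) hε.le (norm_nonneg _)
      by_contra hlt
      push Not at hlt
      exact hball (show (t : ℂ) ∈ Metric.ball r δ by rwa [Metric.mem_ball, dist_eq_norm]) ⟨t, ht, rfl⟩
  obtain ⟨ε, hε, h1⟩ := key d.roots fun r hr t ht e =>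
    hd t ht (e ▸ (mem_roots'.1 hr).2)
  refine ⟨‖d.leadingCoeff‖ * ε, mul_pos (norm_pos_iff.2 (leadingCoeff_ne_zero.2 h0)) hε,
    fun t ht => ?_⟩
  conv_rhs => rw [(IsAlgClosed.splits d).eq_prod_roots]
  rw [eval_mul, eval_C, norm_mul, eval_multiset_prod, Multiset.map_map]
  refine mul_le_mul_of_nonneg_left ?_ (norm_nonneg _)
  simpa using h1 t ht

variable (μ : Matrix (Fin q) (Fin p) (ComplexMeasure ℝ))

lemma isClosed_supp : IsClosed (supp μ) :=
  isClosed_iUnion_of_finite fun _ => isClosed_iUnion_of_finite fun _ => Measure.isClosed_support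

lemma ae_mem_supp (b : Fin q) (a : Fin p) : ∀ᵐ t ∂(μ b a).variation, t ∈ supp μ := by
  filter_upwards [Measure.support_mem_ae (μ := (μ b a).variation)] with t ht
  exact Set.mem_iUnion₂.2 ⟨b, a, ht⟩

lemma integ_congr {b : Fin q} {a : Fin p} {f g : ℂ → ℂ} (h : ∀ t ∈ supp μ, f (t : ℂ) = g (t : ℂ)) :
    integ μ b a f = integ μ b a g :=
  VectorMeasure.integral_congr_ae ((ae_mem_supp μ b a).mono fun t ht => h t ht)

variable {μ}

open Polynomial in
lemma integrable_eval_div (hμ : ∀ b a (k : ℕ), (μ b a).Integrable fun t : ℝ => (t : ℂ) ^ k)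
    {d : ℂ[X]} (hd : ∀ t ∈ supp μ, d.eval (t : ℂ) ≠ 0) (b : Fin q) (a : Fin p) (P : ℂ[X]) :
    (μ b a).Integrable fun t : ℝ => P.eval (t : ℂ) / d.eval (t : ℂ) := by
  have hP : (μ b a).Integrable fun t : ℝ => P.eval (t : ℂ) := by
    simp only [eval_eq_sum_range]
    exact integrable_finsetSum _ fun k _ => (hμ b a k).const_mul _
  obtain ⟨ε, hε, h⟩ := exists_le_norm_eval (isClosed_supp μ) hd
  refine Integrable.mono (hP.const_mul ((ε : ℂ)⁻¹)) ?_ ?_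
  · refine Measurable.aestronglyMeasurable ?_
    have h1 : ∀ P : ℂ[X], Measurable fun t : ℝ => P.eval (t : ℂ) := fun P =>
      (P.continuous.comp Complex.continuous_ofReal).measurable
    exact (h1 P).div (h1 d)
  · filter_upwards [ae_mem_supp μ b a] with t ht
    rw [norm_div, norm_mul, norm_inv, Complex.norm_real, Real.norm_of_nonneg hε.le, div_eq_inv_mul]
    gcongr
    exact h t ht

open Polynomial in
/-- The linear functional `P ↦ ∫ P dμ_{b,a} / d` on polynomials, for a polynomial `d` without zeros
on the support of `μ`. -/
def integDiv (hμ : ∀ b a (k : ℕ), (μ b a).Integrable fun t : ℝ => (t : ℂ) ^ k)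
    {d : ℂ[X]} (hd : ∀ t ∈ supp μ, d.eval (t : ℂ) ≠ 0) (b : Fin q) (a : Fin p) : ℂ[X] →ₗ[ℂ] ℂ where
  toFun P := integ μ b a fun z => P.eval z / d.eval z
  map_add' P Q := by
    simp only [eval_add, add_div]
    exact VectorMeasure.integral_fun_add (integrable_eval_div hμ hd b a P)
      (integrable_eval_div hμ hd b a Q)
  map_smul' c P := by
    simp only [eval_smul, RingHom.id_apply, smul_eq_mul, mul_div_assoc]
    -- Complex homogeneity holds because scalars commute with the multiplication pairing that
    -- defines the integral.
    exact setToFun_smul (𝕜 := ℂ) _ (fun c s x => by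
      simp [VectorMeasure.transpose, mul_left_comm]) c fun t : ℝ => P.eval (t : ℂ) / d.eval (t : ℂ)

open Polynomial in
lemma integDiv_apply (hμ : ∀ b a (k : ℕ), (μ b a).Integrable fun t : ℝ => (t : ℂ) ^ k)
    {d : ℂ[X]} (hd : ∀ t ∈ supp μ, d.eval (t : ℂ) ≠ 0) (b : Fin q) (a : Fin p) (P : ℂ[X]) :
    integDiv hμ hd b a P = integ μ b a fun z => P.eval z / d.eval z :=
  rfl

open Polynomial in
lemma integ_eq_integDiv (hμ : ∀ b a (k : ℕ), (μ b a).Integrable fun t : ℝ => (t : ℂ) ^ k)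
    {d : ℂ[X]} (hd : ∀ t ∈ supp μ, d.eval (t : ℂ) ≠ 0) {b : Fin q} {a : Fin p} {f : ℂ → ℂ} {P : ℂ[X]}
    (h : ∀ t ∈ supp μ, f (t : ℂ) = P.eval (t : ℂ) / d.eval (t : ℂ)) :
    integ μ b a f = integDiv hμ hd b a P := by
  rw [integDiv_apply]
  exact integ_congr μ (g := fun z => P.eval z / d.eval z) h

end

section

/-! ### Coefficients of normalized matrix polynomials -/

namespace IsNormalized

variable {R : Matrix (Fin p) (Fin p) (Polynomial ℂ)} {N r : ℕ}

/-- The monomial x^s e_a has index s p + a in the graded basis. Thus no entry of R raises the index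
by more than M = N p - r, and the entries raising it by exactly M have coefficient 1
(`coeff_eq_one`). -/
lemma coeff_eq_zero (hR : IsNormalized R N r) (hr : r < p) (hM : M + r = N * p)
    {a c : Fin p} {s : ℕ} (h : c + M < s * p + a) : (R a c).coeff s = 0 := by
  have ha := a.2
  have hc := c.2
  rcases lt_trichotomy s N with hs | rfl | hs
  · obtain ⟨k, rfl⟩ : ∃ k, N = s + 1 + k := ⟨N - (s + 1), by omega⟩
    -- M > (N - 1) p rules out s ≤ N - 2, so only the normalized coefficients of x^N and x^(N-1)
    -- matter.
    have hk : k = 0 := by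
      by_contra hk
      have : 1 * p ≤ k * p := Nat.mul_le_mul_right p (Nat.pos_of_ne_zero hk)
      have e : (s + 1 + k) * p = s * p + p + k * p := by ring
      omega
    subst hk
    have e : (s + 1 + 0) * p = s * p + p := by ring
    have := hR.subleading a c (by omega) (by omega)
    rw [if_neg (by omega)] at this
    exact this
  · rw [hR.leading, if_neg (by omega)]
  · exact hR.degree a c s hs

lemma coeff_eq_one (hR : IsNormalized R N r) (hr : r < p) (hM : M + r = N * p)
    {a c : Fin p} {s : ℕ} (h : s * p + a = c + M) : (R a c).coeff s = 1 := by
  have ha := a.2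
  have hc := c.2
  rcases lt_trichotomy s N with hs | rfl | hs
  · obtain ⟨k, rfl⟩ : ∃ k, N = s + 1 + k := ⟨N - (s + 1), by omega⟩
    have hk : k = 0 := by
      by_contra hk
      have : 1 * p ≤ k * p := Nat.mul_le_mul_right p (Nat.pos_of_ne_zero hk)
      have e : (s + 1 + k) * p = s * p + p + k * p := by ring
      omega
    subst hk
    have e : (s + 1 + 0) * p = s * p + p := by ring
    have := hR.subleading a c (by omega) (by omega)
    rw [if_pos (by omega)] at this
    exact this
  · rw [hR.leading, if_pos (by omega)]
  · obtain ⟨k, rfl⟩ : ∃ k, s = N + 1 + k := ⟨s - (N + 1), by omega⟩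
    have e : (N + 1 + k) * p = N * p + p + k * p := by ring
    omega

end IsNormalized

/-! ### Polynomial vectors and their graded coefficients -/

open Polynomial in
/-- The `j`-th vector of the monomial basis `e_1, …, e_p, x e_1, …, x e_p, …`. -/
def monoVec (p : ℕ) [NeZero p] (j : ℕ) : Fin p → ℂ[X] :=
  Pi.single (Fin.ofNat p j) (X ^ (j / p))

lemma monoVec_of_ne [NeZero p] {j : ℕ} {a : Fin p} (h : a ≠ Fin.ofNat p j) : monoVec p j a = 0 :=
  Pi.single_eq_of_ne h _

open Polynomial in
/-- The `j`-th coordinate of a polynomial vector in the monomial basis. -/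
def coord (p : ℕ) [NeZero p] (j : ℕ) : (Fin p → ℂ[X]) →ₗ[ℂ] ℂ :=
  lcoeff ℂ (j / p) ∘ₗ LinearMap.proj (Fin.ofNat p j)

variable [NeZero p]

lemma coord_apply (j : ℕ) (g : Fin p → Polynomial ℂ) :
    coord p j g = (g (Fin.ofNat p j)).coeff (j / p) :=
  rfl

lemma coeff_eq_coord (g : Fin p → Polynomial ℂ) (a : Fin p) (k : ℕ) :
    (g a).coeff k = coord p (k * p + a) g := by
  have h1 : Fin.ofNat p (k * p + a) = a := by
    ext
    simp [Fin.ofNat, Nat.mod_eq_of_lt a.2]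
  have h2 : (k * p + a) / p = k := by
    rw [mul_comm, Nat.mul_add_div (NeZero.pos p), Nat.div_eq_of_lt a.2, add_zero]
  rw [coord_apply, h1, h2]

lemma ext_coord {g h : Fin p → Polynomial ℂ} (H : ∀ j, coord p j g = coord p j h) : g = h := by
  ext a k
  rw [coeff_eq_coord, coeff_eq_coord, H]

lemma coord_monoVec (i j : ℕ) : coord p j (monoVec p i) = if i = j then 1 else 0 := by
  rw [coord_apply, monoVec, Pi.single_apply]
  have key : i = j ↔ Fin.ofNat p j = Fin.ofNat p i ∧ j / p = i / p := by
    constructor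
    · rintro rfl
      exact ⟨rfl, rfl⟩
    · rintro ⟨h1, h2⟩
      have h3 : j % p = i % p := congrArg Fin.val h1
      rw [← Nat.div_add_mod i p, ← Nat.div_add_mod j p, h2, h3]
  split_ifs with h1 h2 h2
  · rw [Polynomial.coeff_X_pow, if_pos (key.1 h2).2]
  · rw [Polynomial.coeff_X_pow, if_neg fun h => h2 (key.2 ⟨h1, h⟩)]
  · exact absurd (key.1 h2).1 h1
  · simp

lemma eq_sum_monoVec {g : Fin p → Polynomial ℂ} {n : ℕ} (h : ∀ j, n ≤ j → coord p j g = 0) :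
    g = ∑ i ∈ Finset.range n, coord p i g • monoVec p i := by
  refine ext_coord fun j => ?_
  simp only [map_sum, map_smul, coord_monoVec, smul_eq_mul, mul_ite, mul_one, mul_zero,
    Finset.sum_ite_eq', Finset.mem_range]
  split_ifs with hj
  · rfl
  · exact h j (not_lt.1 hj)

lemma exists_coord_eq_zero (g : Fin p → Polynomial ℂ) : ∃ n, ∀ j, n ≤ j → coord p j g = 0 := by
  refine ⟨(Finset.univ.sup (fun a => (g a).natDegree) + 1) * p, fun j hj => ?_⟩
  rw [coord_apply]
  refine Polynomial.coeff_eq_zero_of_natDegree_lt ?_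
  have h1 := (Nat.le_div_iff_mul_le (NeZero.pos p)).2 hj
  have h2 := Finset.le_sup (f := fun a => (g a).natDegree) (Finset.mem_univ (Fin.ofNat p j))
  omega

lemma sum_monomial_eq [NeZero q] (c : ℕ → ℂ) (n : ℕ) (b : Fin q) :
    ∑ i ∈ Finset.range n with i % q = b, Polynomial.monomial (i / q) (c i) =
      (∑ i ∈ Finset.range n, c i • monoVec q i) b := by
  rw [Finset.sum_filter, Finset.sum_apply]
  refine Finset.sum_congr rfl fun i _ => ?_
  rw [Pi.smul_apply, monoVec, Pi.single_apply]
  have : b = Fin.ofNat q i ↔ i % q = b := ⟨fun h => by rw [h]; rfl, fun h => Fin.ext h.symm⟩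
  simp only [this]
  split_ifs
  · rw [← Polynomial.C_mul_X_pow_eq_monomial, Polynomial.smul_eq_C_mul]
  · rw [smul_zero]

lemma polyB_eq [NeZero q] (S : Matrix ℕ ℕ ℂ) (n : ℕ) :
    polyB S n = ∑ i ∈ Finset.range (n + 1), S n i • monoVec q i :=
  funext fun b => sum_monomial_eq (S n) (n + 1) b

lemma polyA_eq (Sbar : Matrix ℕ ℕ ℂ) (H : ℕ → ℂ) (n : ℕ) :
    polyA Sbar H n = ∑ j ∈ Finset.range (n + 1), (Sbar n j / H n) • monoVec p j :=
  funext fun a => sum_monomial_eq (fun j => Sbar n j / H n) (n + 1) a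

lemma coord_polyA_of_lt (Sbar : Matrix ℕ ℕ ℂ) (H : ℕ → ℂ) {n j : ℕ} (h : n < j) :
    coord p j (polyA Sbar H n) = 0 := by
  rw [polyA_eq]
  simp [coord_monoVec]
  omega

lemma coord_polyA_self {Sbar : Matrix ℕ ℕ ℂ} (hS : LowerUnitriangular Sbar) (H : ℕ → ℂ) (n : ℕ) :
    coord p n (polyA Sbar H n) = (H n)⁻¹ := by
  rw [polyA_eq]
  simp [coord_monoVec, hS.diag]

/-! ### Normalized matrix polynomials -/

namespace IsNormalized

variable {R : Matrix (Fin p) (Fin p) (Polynomial ℂ)} {N r : ℕ}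

lemma coord_mulVec_monoVec (hR : IsNormalized R N r) (hr : r < p) (hM : M + r = N * p) {n j : ℕ}
    (hj : n + M ≤ j) :
    coord p j (R.mulVec (monoVec p n)) = if j = n + M then 1 else 0 := by
  rw [coord_apply, monoVec, Matrix.mulVec_single]
  simp only [MulOpposite.smul_eq_mul_unop, MulOpposite.unop_op, Pi.smul_apply, Matrix.col_apply]
  rw [Polynomial.coeff_mul_X_pow']
  have h1 : n / p ≤ j / p := Nat.div_le_div_right (by omega)
  rw [if_pos h1]
  have e1 := Nat.div_add_mod j p
  have e2 := Nat.div_add_mod n p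
  obtain ⟨s, hs⟩ := Nat.exists_eq_add_of_le h1
  have e3 : p * (j / p) = p * (n / p) + s * p := by rw [hs]; ring
  rw [hs, Nat.add_sub_cancel_left]
  have v1 : ((Fin.ofNat p j : Fin p) : ℕ) = j % p := rfl
  have v2 : ((Fin.ofNat p n : Fin p) : ℕ) = n % p := rfl
  split_ifs with h
  · exact hR.coeff_eq_one hr hM (by rw [v1, v2]; omega)
  · exact hR.coeff_eq_zero hr hM (by rw [v1, v2]; omega)

lemma coord_mulVec (hR : IsNormalized R N r) (hr : r < p) (hM : M + r = N * p)
    {g : Fin p → Polynomial ℂ} {n : ℕ} (hg : ∀ j, n < j → coord p j g = 0) {j : ℕ} (hj : n + M ≤ j) :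
    coord p j (R.mulVec g) = if j = n + M then coord p n g else 0 := by
  conv_lhs => rw [eq_sum_monoVec (n := n + 1) hg, Matrix.mulVec_sum]
  simp only [Matrix.mulVec_smul, map_sum, map_smul]
  rw [Finset.sum_range_succ, Finset.sum_eq_zero, zero_add,
    hR.coord_mulVec_monoVec hr hM hj, smul_eq_mul, mul_ite, mul_one, mul_zero]
  intro i hi
  have hi := Finset.mem_range.1 hi
  rw [hR.coord_mulVec_monoVec hr hM (by omega), if_neg (by omega), smul_zero]

/-- A nonzero vector with top index m is sent by R to one with the same nonzero coordinate at index
m + M, so R has no kernel. -/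
lemma det_ne_zero (hR : IsNormalized R N r) (hr : r < p) (hM : M + r = N * p) : R.det ≠ 0 := by
  intro h0
  obtain ⟨v, hv, hRv⟩ := Matrix.exists_mulVec_eq_zero_iff.2 h0
  classical
  have hex := exists_coord_eq_zero v
  obtain ⟨m, hm⟩ : ∃ m, Nat.find hex = m + 1 := by
    refine Nat.exists_eq_succ_of_ne_zero fun h => hv (ext_coord fun j => ?_)
    rw [Nat.find_spec hex j (by omega), map_zero]
  refine Nat.find_min hex (m := m) (by omega) fun j hj => ?_
  rcases hj.eq_or_lt with rfl | hj
  · have := hR.coord_mulVec hr hM (g := v) (n := m)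
      (fun j hj => Nat.find_spec hex j (by omega)) le_rfl
    rw [hRv, map_zero, if_pos rfl] at this
    exact this.symm
  · exact Nat.find_spec hex j (by omega)

/-- In each term of the Leibniz expansion, deg R_{σ(i),i} · p + σ(i) ≤ i + M. Summing over i, the
row and column indices cancel. -/
lemma natDegree_det_le (hR : IsNormalized R N r) (hr : r < p) (hM : M + r = N * p) :
    R.det.natDegree ≤ M := by
  rw [Matrix.det_apply]
  refine Polynomial.natDegree_sum_le_of_forall_le _ _ fun σ _ => ?_
  refine (Polynomial.natDegree_smul_le _ _).trans ?_
  by_cases h0 : ∏ i, R (σ i) i = 0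
  · rw [h0, Polynomial.natDegree_zero]
    exact Nat.zero_le _
  refine (Polynomial.natDegree_prod_le _ _).trans ?_
  have h1 : ∀ i, (R (σ i) i).natDegree * p + (σ i : ℕ) ≤ i + M := by
    intro i
    by_contra h
    push Not at h
    have h2 := hR.coeff_eq_zero hr hM h
    exact Finset.prod_ne_zero_iff.1 h0 i (Finset.mem_univ i) (Polynomial.leadingCoeff_eq_zero.1 h2)
  have h2 := Finset.sum_le_sum fun i (_ : i ∈ Finset.univ) => h1 i
  rw [Finset.sum_add_distrib, Finset.sum_add_distrib, ← Finset.sum_mul,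
    Equiv.sum_comp σ fun i : Fin p => (i : ℕ), Finset.sum_const, Finset.card_univ,
    Fintype.card_fin, smul_eq_mul] at h2
  refine Nat.le_of_mul_le_mul_left (c := p) ?_ (NeZero.pos p)
  rw [mul_comm]
  simpa using (by omega : (∑ i, (R (σ i) i).natDegree) * p ≤ p * M)

end IsNormalized

/-- The M distinct roots `x_i` exhaust a nonzero polynomial of degree at most M. -/
lemma GeronimusData.IsSpectral.exists_eq_of_isRoot {G : GeronimusData p q M} (hG : G.IsSpectral)
    {N r : ℕ} (hR : IsNormalized G.R N r) (hr : r < p) (hM : M + r = N * p) {z : ℂ}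
    (hz : G.R.det.IsRoot z) : ∃ i, z = G.x i := by
  classical
  have hsub : Finset.univ.image G.x ⊆ G.R.det.roots.toFinset := by
    intro y hy
    obtain ⟨i, -, rfl⟩ := Finset.mem_image.1 hy
    exact Multiset.mem_toFinset.2 ((Polynomial.mem_roots (hR.det_ne_zero hr hM)).2 (hG.isRoot i))
  have hcard : G.R.det.roots.toFinset.card ≤ (Finset.univ.image G.x).card := by
    rw [Finset.card_image_of_injective _ hG.injective, Finset.card_univ, Fintype.card_fin]
    exact (Multiset.toFinset_card_le _).trans
      ((Polynomial.card_roots' _).trans (hR.natDegree_det_le hr hM))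
  have hmem : z ∈ G.R.det.roots.toFinset :=
    Multiset.mem_toFinset.2 ((Polynomial.mem_roots (hR.det_ne_zero hr hM)).2 hz)
  rw [← Finset.eq_of_subset_of_card_le hsub hcard] at hmem
  obtain ⟨i, -, rfl⟩ := Finset.mem_image.1 hmem
  exact ⟨i, rfl⟩

end

/-! ### Bilinear forms with a Gauss--Borel factorization -/

namespace GaussBorel

variable [NeZero p] [NeZero q]
  {β : (Fin q → Polynomial ℂ) →ₗ[ℂ] (Fin p → Polynomial ℂ) →ₗ[ℂ] ℂ}
  {S Sbar : Matrix ℕ ℕ ℂ} {H : ℕ → ℂ}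

lemma biorthogonal (h : GaussBorel (fun i j => β (monoVec q i) (monoVec p j)) S Sbar H) (n m : ℕ) :
    β (polyB S n) (polyA Sbar H m) = if n = m then 1 else 0 := by
  have h1 : β (polyB S n) (polyA Sbar H m) = (∑ i ∈ Finset.range (n + 1),
      ∑ j ∈ Finset.range (m + 1), S n i * β (monoVec q i) (monoVec p j) * Sbar m j) / H m := by
    rw [polyB_eq, polyA_eq]
    simp only [map_sum, map_smul, LinearMap.sum_apply, LinearMap.smul_apply, smul_eq_mul,
      Finset.sum_div, Finset.mul_sum]
    rw [Finset.sum_comm]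
    refine Finset.sum_congr rfl fun i _ => Finset.sum_congr rfl fun j _ => ?_
    ring
  rw [h1, h.factor]
  split_ifs with e
  · rw [e, div_self (h.diag_ne_zero m)]
  · rw [zero_div]

/-- A_n has top coordinate 1 / H_n, so a multiple of it removes the top coordinate of g;
biorthogonality identifies the coefficients. -/
lemma eq_sum_polyA (h : GaussBorel (fun i j => β (monoVec q i) (monoVec p j)) S Sbar H) {n : ℕ}
    {g : Fin p → Polynomial ℂ} (hg : ∀ j, n ≤ j → coord p j g = 0) :
    g = ∑ m ∈ Finset.range n, β (polyB S m) g • polyA Sbar H m := by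
  induction n generalizing g with
  | zero =>
    rw [Finset.range_zero, Finset.sum_empty]
    exact ext_coord fun j => by rw [hg j (Nat.zero_le j), map_zero]
  | succ n ih =>
    have hg' : ∀ j, n ≤ j → coord p j (g - (coord p n g * H n) • polyA Sbar H n) = 0 := by
      intro j hj
      rw [map_sub, map_smul, smul_eq_mul]
      rcases hj.eq_or_lt with rfl | hj
      · rw [coord_polyA_self h.right, mul_assoc, mul_inv_cancel₀ (h.diag_ne_zero n), mul_one, sub_self]
      · rw [hg j hj, coord_polyA_of_lt _ _ hj, mul_zero, sub_zero]
    have e := ih hg'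
    have e1 : ∀ m, β (polyB S m) g = β (polyB S m) (g - (coord p n g * H n) • polyA Sbar H n) +
        if m = n then coord p n g * H n else 0 := by
      intro m
      rw [map_sub, map_smul, h.biorthogonal, smul_eq_mul, mul_ite, mul_one, mul_zero, sub_add_cancel]
    have e2 : β (polyB S n) (g - (coord p n g * H n) • polyA Sbar H n) = 0 := by
      rw [e]
      simp only [map_sum, map_smul, h.biorthogonal]
      refine Finset.sum_eq_zero fun m hm => ?_
      rw [if_neg (Finset.mem_range.1 hm).ne', smul_zero]
    rw [Finset.sum_range_succ, e1 n, e2, zero_add, if_pos rfl]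
    have e3 : ∑ m ∈ Finset.range n, β (polyB S m) g • polyA Sbar H m =
        g - (coord p n g * H n) • polyA Sbar H n := by
      conv_rhs => rw [e]
      refine Finset.sum_congr rfl fun m hm => ?_
      rw [e1 m, if_neg (Finset.mem_range.1 hm).ne, add_zero]
    rw [e3, sub_add_cancel]

lemma apply_eq_coord (h : GaussBorel (fun i j => β (monoVec q i) (monoVec p j)) S Sbar H) {n : ℕ}
    {g : Fin p → Polynomial ℂ} (hg : ∀ j, n < j → coord p j g = 0) :
    β (polyB S n) g = coord p n g * H n := by
  have e := congrArg (coord p n) (h.eq_sum_polyA (n := n + 1) hg)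
  rw [map_sum, Finset.sum_range_succ, Finset.sum_eq_zero, zero_add, map_smul,
    coord_polyA_self h.right, smul_eq_mul] at e
  · rw [e, mul_assoc, inv_mul_cancel₀ (h.diag_ne_zero n), mul_one]
  · intro m hm
    rw [map_smul, coord_polyA_of_lt _ _ (Finset.mem_range.1 hm), smul_zero]

lemma apply_eq_zero (h : GaussBorel (fun i j => β (monoVec q i) (monoVec p j)) S Sbar H) {n : ℕ}
    {g : Fin p → Polynomial ℂ} (hg : ∀ j, n ≤ j → coord p j g = 0) :
    β (polyB S n) g = 0 := by
  rw [h.apply_eq_coord fun j hj => hg j hj.le, hg n le_rfl, zero_mul]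

end GaussBorel

/-! ### Connection matrices -/

section Connection

variable {S Sc : Matrix ℕ ℕ ℂ}

lemma sum_triInv_mul (hS : LowerUnitriangular S) (i j : ℕ) :
    ∑ k ∈ Finset.range (i + 1), triInv S i k * S k j = if i = j then 1 else 0 := by
  rcases lt_or_ge i j with hij | hij
  · rw [if_neg hij.ne]
    refine Finset.sum_eq_zero fun k hk => ?_
    rw [hS.upper k j (by have := Finset.mem_range.1 hk; omega), mul_zero]
  set T : Matrix (Fin (i + 1)) (Fin (i + 1)) ℂ := Matrix.of fun k l => S k l with hT
  have hdet : T.det = 1 := by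
    rw [Matrix.det_of_isLowerTriangular T fun a b hab => hS.upper a b hab]
    exact Finset.prod_eq_one fun k _ => hS.diag k
  have hinv : T⁻¹ * T = 1 := Matrix.nonsing_inv_mul T (by rw [hdet]; exact isUnit_one)
  have h := congrFun (congrFun hinv (Fin.last i)) ⟨j, Nat.lt_succ_of_le hij⟩
  rw [Matrix.mul_apply, Matrix.one_apply] at h
  rw [Finset.sum_range]
  have e : ∀ k : Fin (i + 1), triInv S i k = T⁻¹ (Fin.last i) k := fun k => by
    rw [triInv, dif_pos (Nat.lt_succ_iff.1 k.2)]
  simp only [e]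
  refine h.trans ?_
  simp [Fin.ext_iff]

lemma triInv_of_lt {i j : ℕ} (h : i < j) : triInv S i j = 0 :=
  dif_neg (not_le.2 h)

lemma triInv_self (hS : LowerUnitriangular S) (i : ℕ) : triInv S i i = 1 := by
  have h := sum_triInv_mul hS i i
  rw [Finset.sum_range_succ, hS.diag, mul_one, Finset.sum_eq_zero, zero_add, if_pos rfl] at h
  · exact h
  · intro k hk
    rw [hS.upper k i (Finset.mem_range.1 hk), mul_zero]

lemma connection_of_lt {n m : ℕ} (h : n < m) : connection Sc S n m = 0 :=
  Finset.sum_eq_zero fun k hk => by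
    rw [triInv_of_lt (by have := Finset.mem_range.1 hk; omega), mul_zero]

lemma connection_self (hS : LowerUnitriangular S) (hSc : LowerUnitriangular Sc) (n : ℕ) :
    connection Sc S n n = 1 := by
  rw [connection, Finset.sum_range_succ, Finset.sum_eq_zero, zero_add, hSc.diag, triInv_self hS,
    mul_one]
  intro k hk
  rw [triInv_of_lt (Finset.mem_range.1 hk), mul_zero]

/-- This is Ω S = Š, the defining relation of Ω with S⁻¹ cancelled. -/
lemma sum_connection_mul (hS : LowerUnitriangular S) {n j : ℕ} (hj : j ≤ n) :
    ∑ k ∈ Finset.range (n + 1), connection Sc S n k * S k j = Sc n j := by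
  have h1 : ∀ i ∈ Finset.range (n + 1), ∑ k ∈ Finset.range (n + 1), triInv S i k * S k j =
      if i = j then 1 else 0 := by
    intro i hi
    rw [← sum_triInv_mul hS i j]
    -- Triangularity lets the inner range be independent of i, so that the sums can be exchanged.
    refine (Finset.sum_subset (Finset.range_mono (by have := Finset.mem_range.1 hi; omega)) ?_).symm
    intro k _ hk
    rw [triInv_of_lt (by simpa using hk), zero_mul]
  simp only [connection, Finset.sum_mul]
  rw [Finset.sum_comm]
  simp only [mul_assoc, ← Finset.mul_sum]
  rw [Finset.sum_congr rfl fun i hi => by rw [h1 i hi]]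
  simp [Nat.lt_succ_of_le hj]

lemma polyB_eq_sum_connection [NeZero q] (hS : LowerUnitriangular S) (n : ℕ) :
    (polyB Sc n : Fin q → Polynomial ℂ) =
      ∑ k ∈ Finset.range (n + 1), connection Sc S n k • polyB S k := by
  have h1 : ∀ k ∈ Finset.range (n + 1), (polyB S k : Fin q → Polynomial ℂ) =
      ∑ i ∈ Finset.range (n + 1), S k i • monoVec q i := by
    intro k hk
    rw [polyB_eq]
    refine Finset.sum_subset (Finset.range_mono (by have := Finset.mem_range.1 hk; omega)) ?_
    intro i _ hi
    rw [hS.upper k i (by simpa using hi), zero_smul]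
  rw [Finset.sum_congr rfl fun k hk => by rw [h1 k hk], polyB_eq]
  simp only [Finset.smul_sum, smul_smul]
  rw [Finset.sum_comm]
  refine Finset.sum_congr rfl fun i hi => ?_
  rw [← Finset.sum_smul, sum_connection_mul hS (by have := Finset.mem_range.1 hi; omega)]

end Connection

/-! ### Determinants of bordered matrices -/

section Determinants

/-- Replacing the last row by the combination with weights ω keeps the determinant, since the last
weight is 1. The new row is zero except in the border column. -/
lemma det_bordered_of_sum_eq_zero {n : ℕ} (W : Fin (n + 1) → Fin n → ℂ) (y ω : Fin (n + 1) → ℂ)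
    (hω : ω (Fin.last n) = 1) (h : ∀ i, ∑ k, ω k * W k i = 0) :
    (Matrix.of fun k => (Fin.snoc (W k) (y k) : Fin (n + 1) → ℂ)).det =
      (∑ k, ω k * y k) * (Matrix.of fun k i : Fin n => W k.castSucc i).det := by
  set A : Matrix (Fin (n + 1)) (Fin (n + 1)) ℂ :=
    Matrix.of fun k => (Fin.snoc (W k) (y k) : Fin (n + 1) → ℂ) with hA
  have h1 := Matrix.det_updateRow_sum A (Fin.last n) ω
  rw [hω, one_smul] at h1
  have hrow : ∑ k, ω k • A k = Fin.snoc (fun _ => 0) (∑ k, ω k * y k) := by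
    funext i
    rw [Finset.sum_apply]
    refine Fin.lastCases ?_ (fun i => ?_) i
    · simp [hA]
    · simpa [hA] using h i
  rw [← h1, hrow, Matrix.det_succ_row _ (Fin.last n), Fin.sum_univ_castSucc,
    Finset.sum_eq_zero, zero_add]
  · have hs : (A.updateRow (Fin.last n) (Fin.snoc (fun _ => 0) (∑ k, ω k * y k))).submatrix
        (Fin.last n).succAbove (Fin.last n).succAbove =
        Matrix.of fun k i : Fin n => W k.castSucc i := by
      ext k i
      simp [hA, Matrix.updateRow_apply, (Fin.castSucc_lt_last k).ne]
    rw [hs, Matrix.updateRow_self, Fin.snoc_last, ← two_mul, pow_mul]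
    simp
  · intro i _
    simp

lemma coeff_eq_minor_of_sum_eq_zero {n : ℕ} (W : Fin (n + 1) → Fin n → ℂ) (ω : Fin (n + 1) → ℂ)
    (hω : ω (Fin.last n) = 1) (h : ∀ i, ∑ k, ω k * W k i = 0) (k : Fin (n + 1)) :
    ω k * (Matrix.of fun l i : Fin n => W l.castSucc i).det =
      (-1) ^ ((k : ℕ) + n) * (Matrix.of fun l i : Fin n => W (k.succAbove l) i).det := by
  -- Bordering by the k-th unit vector isolates ω_k on one side and a signed minor on the other.
  have h1 := det_bordered_of_sum_eq_zero W (Pi.single k 1) ω hω h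
  simp only [Pi.single_apply, mul_ite, mul_one, mul_zero, Finset.sum_ite_eq', Finset.mem_univ,
    if_true] at h1
  rw [← h1, Matrix.det_succ_column _ (Fin.last n), Finset.sum_eq_single k]
  · simp only [Matrix.of_apply, Fin.snoc_last, if_true, mul_one, Fin.val_last]
    congr 2
    ext l i
    simp
  · intro l _ hl
    simp [hl]
  · simp

end Determinants

/-! ### The bilinear forms of a Geronimus perturbation -/

section Pairing

open Polynomial

/-- The bilinear form `(f, g) ↦ ∑ ℓ_{b,a} (f_b g_a)` of a matrix of functionals on polynomials. -/
def pairing (ℓ : Fin q → Fin p → ℂ[X] →ₗ[ℂ] ℂ) : (Fin q → ℂ[X]) →ₗ[ℂ] (Fin p → ℂ[X]) →ₗ[ℂ] ℂ :=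
  LinearMap.mk₂ ℂ (fun f g => ∑ b, ∑ a, ℓ b a (f b * g a))
    (fun f f' g => by simp [add_mul, Finset.sum_add_distrib])
    (fun c f g => by simp [Finset.mul_sum])
    (fun f g g' => by simp [mul_add, Finset.sum_add_distrib])
    (fun c f g => by simp [Finset.mul_sum])

lemma pairing_apply (ℓ : Fin q → Fin p → ℂ[X] →ₗ[ℂ] ℂ) (f : Fin q → ℂ[X]) (g : Fin p → ℂ[X]) :
    pairing ℓ f g = ∑ b, ∑ a, ℓ b a (f b * g a) :=
  rfl

lemma pairing_monoVec [NeZero q] (ℓ : Fin q → Fin p → ℂ[X] →ₗ[ℂ] ℂ) (i : ℕ) (g : Fin p → ℂ[X]) :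
    pairing ℓ (monoVec q i) g = ∑ a, ℓ (Fin.ofNat q i) a (X ^ (i / q) * g a) := by
  rw [pairing_apply, Finset.sum_eq_single (Fin.ofNat q i)]
  · simp [monoVec]
  · intro b _ hb
    simp [monoVec_of_ne hb]
  · simp

/-- The functional `f ↦ ∑ f_b(z) w_b` on polynomial vectors. -/
def evalDot (z : ℂ) (w : Fin p → ℂ) : (Fin p → ℂ[X]) →ₗ[ℂ] ℂ where
  toFun f := ∑ b, (f b).eval z * w b
  map_add' f g := by simp [add_mul, Finset.sum_add_distrib]
  map_smul' c f := by simp [Finset.mul_sum, mul_assoc]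

lemma evalDot_apply (z : ℂ) (w : Fin p → ℂ) (f : Fin p → ℂ[X]) :
    evalDot z w f = ∑ b, (f b).eval z * w b :=
  rfl

lemma evalDot_monoVec [NeZero p] (z : ℂ) (w : Fin p → ℂ) (i : ℕ) :
    evalDot z w (monoVec p i) = z ^ (i / p) * w (Fin.ofNat p i) := by
  rw [evalDot_apply, Finset.sum_eq_single (Fin.ofNat p i)]
  · simp [monoVec]
  · intro b _ hb
    simp [monoVec_of_ne hb]
  · simp

lemma evalDot_mulVec (R : Matrix (Fin p) (Fin p) ℂ[X]) (z : ℂ) (w : Fin p → ℂ) (g : Fin p → ℂ[X]) :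
    evalDot z w (R.mulVec g) = ∑ c, Matrix.vecMul w (evalMat R z) c * (g c).eval z := by
  simp only [evalDot_apply, Matrix.mulVec, Matrix.vecMul, dotProduct, eval_finsetSum, eval_mul,
    evalMat, Matrix.map_apply, Finset.sum_mul]
  rw [Finset.sum_comm]
  exact Finset.sum_congr rfl fun c _ => Finset.sum_congr rfl fun a _ => by ring

namespace GeronimusData

variable (G : GeronimusData p q M) (ℓ : Fin q → Fin p → ℂ[X] →ₗ[ℂ] ℂ)

/-- The bilinear form of the perturbed matrix of measures, in terms of the functionals
`ℓ_{b,a} = ∫ · dμ_{b,a} / det R`. -/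
def perturbedPairing : (Fin q → ℂ[X]) →ₗ[ℂ] (Fin p → ℂ[X]) →ₗ[ℂ] ℂ :=
  LinearMap.mk₂ ℂ (fun f g => pairing ℓ f (G.R.adjugate.mulVec g) +
      ∑ i, evalDot (G.x i) (G.ξ i) f * evalDot (G.x i) (G.vL i) g)
    (fun f f' g => by simp only [map_add, LinearMap.add_apply, add_mul, Finset.sum_add_distrib]; ring)
    (fun c f g => by
      simp only [map_smul, LinearMap.smul_apply, smul_eq_mul, mul_add, Finset.mul_sum, mul_assoc])
    (fun f g g' => by
      simp only [Matrix.mulVec_add, map_add, mul_add, Finset.sum_add_distrib]; ring)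
    (fun c f g => by
      simp only [Matrix.mulVec_smul, map_smul, smul_eq_mul, mul_add, Finset.mul_sum, mul_left_comm])

lemma perturbedPairing_apply (f : Fin q → ℂ[X]) (g : Fin p → ℂ[X]) :
    G.perturbedPairing ℓ f g = pairing ℓ f (G.R.adjugate.mulVec g) +
      ∑ i, evalDot (G.x i) (G.ξ i) f * evalDot (G.x i) (G.vL i) g :=
  rfl

/-- The bilinear form of the unperturbed matrix of measures, in terms of the functionals
`ℓ_{b,a} = ∫ · dμ_{b,a} / det R`. -/
def unperturbedPairing : (Fin q → ℂ[X]) →ₗ[ℂ] (Fin p → ℂ[X]) →ₗ[ℂ] ℂ :=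
  pairing fun b a => ℓ b a ∘ₗ LinearMap.mulLeft ℂ G.R.det

variable {G}

/-- This is dμ̌ R = dμ: the masses disappear by v_i^L R(x_i) = 0, and adj(R) R = det R cancels the
denominator. -/
lemma IsSpectral.perturbedPairing_mulVec (hG : G.IsSpectral) (f : Fin q → ℂ[X])
    (g : Fin p → ℂ[X]) :
    G.perturbedPairing ℓ f (G.R.mulVec g) = G.unperturbedPairing ℓ f g := by
  rw [perturbedPairing_apply, Matrix.mulVec_mulVec, Matrix.adjugate_mul, Matrix.smul_mulVec,
    Matrix.one_mulVec, Finset.sum_eq_zero, add_zero, unperturbedPairing, pairing_apply, pairing_apply]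
  · refine Finset.sum_congr rfl fun b _ => Finset.sum_congr rfl fun a _ => ?_
    simp [mul_left_comm]
  · intro i _
    rw [evalDot_mulVec, hG.left_eigen]
    simp

variable (G)

/-- The polynomial vector `R(x) v_i^R / (x - x_i)`. -/
def eigenQuotient (i : Fin M) : Fin p → ℂ[X] :=
  fun a => G.R.mulVec (fun c => C (G.vR i c)) a /ₘ (X - C (G.x i))

/-- The polynomial `det R(x) / (x - x_i)`. -/
def detQuotient (i : Fin M) : ℂ[X] :=
  G.R.det /ₘ (X - C (G.x i))

variable {G}

lemma eval_mulVec_C (R : Matrix (Fin p) (Fin p) ℂ[X]) (v : Fin p → ℂ) (z : ℂ) (a : Fin p) :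
    (R.mulVec (fun c => C (v c)) a).eval z = (evalMat R z).mulVec v a := by
  simp [Matrix.mulVec, dotProduct, eval_finsetSum, evalMat]

namespace IsSpectral

lemma X_sub_C_mul_eigenQuotient (hG : G.IsSpectral) (i : Fin M) (a : Fin p) :
    (X - C (G.x i)) * G.eigenQuotient i a = G.R.mulVec (fun c => C (G.vR i c)) a := by
  refine mul_divByMonic_eq_iff_isRoot.2 ?_
  rw [IsRoot.def, eval_mulVec_C, hG.right_eigen]
  rfl

lemma X_sub_C_mul_detQuotient (hG : G.IsSpectral) (i : Fin M) :
    (X - C (G.x i)) * G.detQuotient i = G.R.det :=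
  mul_divByMonic_eq_iff_isRoot.2 (hG.isRoot i)

lemma adjugate_mulVec_eigenQuotient (hG : G.IsSpectral) (i : Fin M) (a : Fin p) :
    G.R.adjugate.mulVec (G.eigenQuotient i) a = G.detQuotient i * C (G.vR i a) := by
  refine mul_left_cancel₀ (X_sub_C_ne_zero (G.x i)) ?_
  rw [← mul_assoc, hG.X_sub_C_mul_detQuotient]
  have h : (X - C (G.x i)) • G.eigenQuotient i = G.R.mulVec (fun c => C (G.vR i c)) :=
    funext (hG.X_sub_C_mul_eigenQuotient i)
  have h2 := congrFun (congrArg G.R.adjugate.mulVec h) a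
  rwa [Matrix.mulVec_smul, Matrix.mulVec_mulVec, Matrix.adjugate_mul, Matrix.smul_mulVec,
    Matrix.one_mulVec, Pi.smul_apply, Pi.smul_apply, smul_eq_mul, smul_eq_mul] at h2

lemma eval_eigenQuotient_self (hG : G.IsSpectral) (i : Fin M) (a : Fin p) :
    (G.eigenQuotient i a).eval (G.x i) =
      (evalMat (G.R.map derivative) (G.x i)).mulVec (G.vR i) a := by
  have h := congrArg (fun P => (derivative P).eval (G.x i)) (hG.X_sub_C_mul_eigenQuotient i a)
  simp only [derivative_mul, derivative_sub, derivative_X, derivative_C, eval_add, eval_mul,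
    eval_sub, eval_X, eval_C, sub_self, zero_mul, add_zero, sub_zero, one_mul] at h
  rw [h, ← eval_mulVec_C]
  simp [Matrix.mulVec, dotProduct, derivative_mul]

/-- (x - x_i) E_i = R v_i^R is annihilated by v_j^L at x_j, and x_j - x_i can be divided out when j
≠ i. For j = i the product rule gives E_i(x_i) = R'(x_i) v_i^R. Hence only the i-th mass sees E_i.
-/
lemma evalDot_eigenQuotient (hG : G.IsSpectral) (i j : Fin M) :
    evalDot (G.x j) (G.vL j) (G.eigenQuotient i) = if j = i then G.residue i else 0 := by
  split_ifs with h
  · subst h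
    simp only [evalDot_apply, hG.eval_eigenQuotient_self, residue, dotProduct, mul_comm]
  · have h1 : G.x j - G.x i ≠ 0 := sub_ne_zero.2 fun e => h (hG.injective e)
    refine (mul_eq_zero.1 ?_).resolve_left h1
    have h2 := evalDot_mulVec G.R (G.x j) (G.vL j) fun c => C (G.vR i c)
    rw [hG.left_eigen] at h2
    simp only [Pi.zero_apply, zero_mul, Finset.sum_const_zero] at h2
    rw [← h2, evalDot_apply, evalDot_apply, Finset.mul_sum]
    refine Finset.sum_congr rfl fun a _ => ?_
    rw [← hG.X_sub_C_mul_eigenQuotient]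
    simp [mul_assoc]

lemma perturbedPairing_eigenQuotient (hG : G.IsSpectral) (f : Fin q → ℂ[X]) (i : Fin M) :
    G.perturbedPairing ℓ f (G.eigenQuotient i) =
      (∑ b, ∑ a, ℓ b a (f b * G.detQuotient i) * G.vR i a) +
        evalDot (G.x i) (G.ξ i) f * G.residue i := by
  rw [perturbedPairing_apply, pairing_apply]
  congr 1
  · refine Finset.sum_congr rfl fun b _ => Finset.sum_congr rfl fun a _ => ?_
    rw [hG.adjugate_mulVec_eigenQuotient, mul_comm (G.detQuotient i), ← mul_assoc,
      mul_comm (f b), mul_assoc, ← smul_eq_C_mul, map_smul, smul_eq_mul, mul_comm]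
  · simp [hG.evalDot_eigenQuotient]

/-- R v_i^R has coordinates only up to index M + p - 1, and multiplication by x raises the index by
p. Comparing coordinates in (x - x_i) E_i = R v_i^R, descend in steps of p from an index beyond
which E_i vanishes. -/
lemma coord_eigenQuotient [NeZero p] (hG : G.IsSpectral) {N r : ℕ} (hR : IsNormalized G.R N r)
    (hr : r < p) (hM : M + r = N * p) (i : Fin M) {j : ℕ} (hj : M ≤ j) :
    coord p j (G.eigenQuotient i) = 0 := by
  have hp := NeZero.pos p
  have hv : ∀ j, p - 1 < j → coord p j (fun c => C (G.vR i c)) = 0 := by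
    intro j hj
    have : j / p ≠ 0 := (Nat.div_pos (by omega) hp).ne'
    rw [coord_apply, coeff_C, if_neg this]
  obtain ⟨n, hn⟩ := exists_coord_eq_zero (G.eigenQuotient i)
  have key : ∀ m j, M ≤ j → n ≤ j + m * p → coord p j (G.eigenQuotient i) = 0 := by
    intro m
    induction m with
    | zero => exact fun j _ h => hn j (by omega)
    | succ m ih =>
      intro j hj h
      have h1 := ih (j + p) (by omega) (by linarith)
      have h2 := hR.coord_mulVec hr hM hv (j := j + p) (by omega)
      rw [if_neg (by omega)] at h2
      have e1 : Fin.ofNat p (j + p) = Fin.ofNat p j := Fin.ext (Nat.add_mod_right j p)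
      have e2 : (j + p) / p = j / p + 1 := Nat.add_div_right j hp
      rw [coord_apply, e1, e2] at h1 h2
      rw [← hG.X_sub_C_mul_eigenQuotient, sub_mul, coeff_sub, coeff_X_mul, coeff_C_mul, h1, mul_zero,
        sub_zero] at h2
      exact h2
  refine key n j hj ?_
  have : n * 1 ≤ n * p := Nat.mul_le_mul_left n hp
  omega

/-- Applying adj(R) turns E_i into (det R / (x - x_i)) v_i^R, which reduces the claim to the
independence of Lagrange-type products. -/
lemma eq_zero_of_sum_smul_eigenQuotient (hG : G.IsSpectral) (hdet : G.R.det ≠ 0) {c : Fin M → ℂ}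
    (h : ∑ i, c i • G.eigenQuotient i = 0) : c = 0 := by
  funext j
  obtain ⟨a, ha⟩ := Function.ne_iff.1 (hG.right_ne_zero j)
  have h1 : ∑ i, c i • (G.detQuotient i * C (G.vR i a)) = 0 := by
    have h2 := congrFun (congrArg G.R.adjugate.mulVec h) a
    simpa [Matrix.mulVec_sum, Matrix.mulVec_smul, hG.adjugate_mulVec_eigenQuotient] using h2
  -- Multiplying by ∏ (x - x_k) lets det R be cancelled as a whole, so neither its factorization nor
  -- the simplicity of its zeros is needed.
  have h2 : G.R.det * ∑ i, c i • ((∏ k ∈ Finset.univ.erase i, (X - C (G.x k))) * C (G.vR i a)) =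
      (∏ k, (X - C (G.x k))) * ∑ i, c i • (G.detQuotient i * C (G.vR i a)) := by
    rw [Finset.mul_sum, Finset.mul_sum]
    refine Finset.sum_congr rfl fun i _ => ?_
    rw [← hG.X_sub_C_mul_detQuotient i, ← Finset.mul_prod_erase _ _ (Finset.mem_univ i)]
    simp only [smul_eq_C_mul]
    ring
  rw [h1, mul_zero] at h2
  have h3 := congrArg (eval (G.x j)) ((mul_eq_zero.1 h2).resolve_left hdet)
  rw [eval_finsetSum, Finset.sum_eq_single j] at h3
  · simp only [eval_smul, eval_mul, eval_prod, eval_sub, eval_X, eval_C, eval_zero, smul_eq_mul,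
      mul_eq_zero] at h3
    refine h3.resolve_right fun h4 => h4.elim (fun h4 => ?_) ha
    obtain ⟨k, hk, hk'⟩ := Finset.prod_eq_zero_iff.1 h4
    exact (Finset.mem_erase.1 hk).1 (hG.injective (sub_eq_zero.1 hk').symm)
  · intro i _ hi
    have : ∏ k ∈ Finset.univ.erase i, (G.x j - G.x k) = 0 :=
      Finset.prod_eq_zero (Finset.mem_erase.2 ⟨hi.symm, Finset.mem_univ j⟩) (sub_self _)
    simp [eval_prod, this]
  · simp

end IsSpectral

end GeronimusData

end Pairing

/-! ### Integrals in terms of the bilinear forms -/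

section Integrals

variable {μ : Matrix (Fin q) (Fin p) (ComplexMeasure ℝ)} {G : GeronimusData p q M}
  (hμ : ∀ b a (k : ℕ), (μ b a).Integrable fun t : ℝ => (t : ℂ) ^ k)
  (hd : ∀ t ∈ supp μ, G.R.det.eval (t : ℂ) ≠ 0)

lemma evalMat_inv_apply (R : Matrix (Fin p) (Fin p) (Polynomial ℂ)) (z : ℂ) (c a : Fin p) :
    (evalMat R z)⁻¹ c a = (R.adjugate c a).eval z / R.det.eval z := by
  have h1 : (evalMat R z).det = R.det.eval z :=
    ((Polynomial.evalRingHom z).map_det R).symm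
  have h2 : (evalMat R z).adjugate = R.adjugate.map (Polynomial.eval z) :=
    ((Polynomial.evalRingHom z).map_adjugate R).symm
  rw [Matrix.inv_def, h1, h2, Matrix.smul_apply, Ring.inverse_eq_inv', smul_eq_mul,
    Matrix.map_apply, div_eq_inv_mul]

lemma momentMatrix_integ [NeZero p] [NeZero q] : momentMatrix (integ μ) =
    fun i j => G.unperturbedPairing (integDiv hμ hd) (monoVec q i) (monoVec p j) := by
  funext i j
  rw [GeronimusData.unperturbedPairing, pairing_monoVec, Finset.sum_eq_single (Fin.ofNat p j)]
  · refine integ_eq_integDiv hμ hd fun t ht => ?_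
    simp [monoVec, pow_add, mul_div_cancel_left₀ _ (hd t ht)]
  · intro a _ ha
    simp [monoVec_of_ne ha]
  · simp

lemma momentMatrix_perturbed [NeZero p] [NeZero q] : momentMatrix (G.perturbed μ) =
    fun i j => G.perturbedPairing (integDiv hμ hd) (monoVec q i) (monoVec p j) := by
  funext i j
  rw [GeronimusData.perturbedPairing_apply, pairing_monoVec, momentMatrix, GeronimusData.perturbed]
  congr 1
  · refine Finset.sum_congr rfl fun c _ => integ_eq_integDiv hμ hd fun t ht => ?_
    rw [evalMat_inv_apply, monoVec, Matrix.mulVec_single]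
    simp only [MulOpposite.smul_eq_mul_unop, MulOpposite.unop_op, Pi.smul_apply, Matrix.col_apply,
      Polynomial.eval_mul, Polynomial.eval_pow, Polynomial.eval_X, pow_add]
    ring
  · refine Finset.sum_congr rfl fun k _ => ?_
    rw [evalDot_monoVec, evalDot_monoVec, pow_add]
    ring

/-- Since det R = (t - x_i) · `detQuotient`, the Cauchy kernel 1 / (x_i - t) is minus a polynomial
over det R. That reversal is the source of the sign. -/
lemma GeronimusData.IsSpectral.DW_eq (hG : G.IsSpectral) (hΔ : ∀ i, ∀ t ∈ supp μ, G.x i ≠ (t : ℂ))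
    (S : Matrix ℕ ℕ ℂ) (n : ℕ) (i : Fin M) :
    G.DW μ S n i = -G.perturbedPairing (integDiv hμ hd) (polyB S n) (G.eigenQuotient i) := by
  have h1 : ∀ a, cauchyD μ S n (G.x i) a =
      -∑ b, integDiv hμ hd b a (polyB S n b * G.detQuotient i) := by
    intro a
    rw [cauchyD, ← Finset.sum_neg_distrib]
    refine Finset.sum_congr rfl fun b _ => ?_
    rw [← map_neg]
    refine integ_eq_integDiv hμ hd fun t ht => ?_
    have h2 : G.x i - t ≠ 0 := sub_ne_zero.2 (hΔ i t ht)
    have h3 := congrArg (Polynomial.eval (t : ℂ)) (hG.X_sub_C_mul_detQuotient i)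
    simp only [Polynomial.eval_mul, Polynomial.eval_sub, Polynomial.eval_X, Polynomial.eval_C] at h3
    rw [div_eq_div_iff h2 (hd t ht), ← h3]
    simp only [Polynomial.eval_neg, Polynomial.eval_mul]
    ring
  rw [hG.perturbedPairing_eigenQuotient, DW, DD, WW, neg_add, Finset.sum_comm, sub_eq_add_neg,
    evalDot_apply, Finset.sum_mul]
  congr 1
  rw [← Finset.sum_neg_distrib]
  refine Finset.sum_congr rfl fun a _ => ?_
  rw [h1, neg_mul, Finset.sum_mul]

end Integrals

/-! ### Connection formulas -/

lemma sum_range_window {f : ℕ → ℂ} {n M : ℕ} (hn : M ≤ n) (hf : ∀ k, k + M < n → f k = 0) :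
    ∑ k ∈ Finset.range (n + 1), f k = ∑ k : Fin (M + 1), f (n - M + k) := by
  have e : n + 1 = (n - M) + (M + 1) := by omega
  rw [e, Finset.sum_range_add, Finset.sum_eq_zero, zero_add, Finset.sum_range]
  intro k hk
  exact hf k (by have := Finset.mem_range.1 hk; omega)

lemma det_updateRow_sum_smul {n ι : Type*} [Fintype n] [DecidableEq n] (T : Matrix n n ℂ) (j : n)
    (s : Finset ι) (c : ι → ℂ) (v : ι → n → ℂ) :
    (T.updateRow j (∑ k ∈ s, c k • v k)).det = ∑ k ∈ s, c k * (T.updateRow j (v k)).det := by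
  have h := map_sum (Matrix.detRowAlternating.toMultilinearMap.toLinearMap T j)
    (fun k => c k • v k) s
  simp only [map_smul] at h
  exact h

namespace GeronimusData

/-- The setting of the connection formulas: a Geronimus perturbation for which both bilinear forms
have Gauss--Borel factorizations. -/
structure Connected [NeZero p] [NeZero q] (G : GeronimusData p q M) (N r : ℕ)
    (ℓ : Fin q → Fin p → Polynomial ℂ →ₗ[ℂ] ℂ) (S Sbar Sc Scbar : Matrix ℕ ℕ ℂ)
    (H Hc : ℕ → ℂ) : Prop where
  lt : r < p
  card : M + r = N * p
  normalized : IsNormalized G.R N r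
  spectral : G.IsSpectral
  factor : GaussBorel (fun i j => G.unperturbedPairing ℓ (monoVec q i) (monoVec p j)) S Sbar H
  factorc : GaussBorel (fun i j => G.perturbedPairing ℓ (monoVec q i) (monoVec p j)) Sc Scbar Hc

namespace Connected

variable [NeZero p] [NeZero q] {G : GeronimusData p q M} {N r : ℕ}
  {ℓ : Fin q → Fin p → Polynomial ℂ →ₗ[ℂ] ℂ} {S Sbar Sc Scbar : Matrix ℕ ℕ ℂ} {H Hc : ℕ → ℂ}
  (h : G.Connected N r ℓ S Sbar Sc Scbar H Hc)

include h

lemma connection_eq (n k : ℕ) :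
    connection Sc S n k = G.perturbedPairing ℓ (polyB Sc n) (G.R.mulVec (polyA Sbar H k)) := by
  rw [h.spectral.perturbedPairing_mulVec, polyB_eq_sum_connection h.factor.left]
  simp only [map_sum, map_smul, LinearMap.sum_apply, LinearMap.smul_apply, h.factor.biorthogonal,
    smul_eq_mul, mul_ite, mul_one, mul_zero, Finset.sum_ite_eq', Finset.mem_range]
  split_ifs with hk
  · rfl
  · exact connection_of_lt (by omega)

lemma coord_mulVec_polyA {k j : ℕ} (hj : k + M ≤ j) :
    coord p j (G.R.mulVec (polyA Sbar H k)) = if j = k + M then (H k)⁻¹ else 0 := by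
  rw [h.normalized.coord_mulVec h.lt h.card (fun j hj => coord_polyA_of_lt Sbar H hj) hj,
    coord_polyA_self h.factor.right]

lemma connection_eq_zero {n k : ℕ} (hk : k + M < n) : connection Sc S n k = 0 := by
  rw [h.connection_eq]
  refine h.factorc.apply_eq_zero fun j hj => ?_
  rw [h.coord_mulVec_polyA (by omega), if_neg (by omega)]

/-- The entry equals Ȟ_{k+M} / H_k: only the top coordinate of R A_k, at index k + M, contributes.
-/
lemma connection_add_ne_zero (k : ℕ) : connection Sc S (k + M) k ≠ 0 := by
  rw [h.connection_eq, h.factorc.apply_eq_coord, h.coord_mulVec_polyA le_rfl, if_pos rfl]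
  · exact mul_ne_zero (inv_ne_zero (h.factor.diag_ne_zero k)) (h.factorc.diag_ne_zero _)
  · intro j hj
    rw [h.coord_mulVec_polyA hj.le, if_neg hj.ne']

lemma mulVec_polyA {n k : ℕ} (hk : k + M ≤ n) : G.R.mulVec (polyA Sbar H k) =
    ∑ m ∈ Finset.range (n + 1), connection Sc S m k • polyA Scbar Hc m := by
  simp only [h.connection_eq]
  refine h.factorc.eq_sum_polyA fun j hj => ?_
  rw [h.coord_mulVec_polyA (by omega), if_neg (by omega)]

lemma coord_eigenQuotient (i : Fin M) {j : ℕ} (hj : M ≤ j) : coord p j (G.eigenQuotient i) = 0 :=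
  h.spectral.coord_eigenQuotient h.normalized h.lt h.card i hj

variable {g : ℕ → Fin M → ℂ}
  (hg : ∀ n i, g n i = -G.perturbedPairing ℓ (polyB S n) (G.eigenQuotient i))

include hg

lemma perturbedPairing_polyB_eigenQuotient (n : ℕ) (i : Fin M) :
    G.perturbedPairing ℓ (polyB Sc n) (G.eigenQuotient i) =
      -∑ k ∈ Finset.range (n + 1), connection Sc S n k * g k i := by
  rw [polyB_eq_sum_connection h.factor.left]
  simp [hg]

lemma sum_connection_mul_eq_zero {n : ℕ} (hn : M ≤ n) (i : Fin M) :
    ∑ k : Fin (M + 1), connection Sc S n (n - M + k) * g (n - M + k) i = 0 := by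
  rw [← sum_range_window (f := fun k => connection Sc S n k * g k i) hn fun k hk => by
    rw [h.connection_eq_zero hk, zero_mul]]
  rw [← neg_eq_zero, ← h.perturbedPairing_polyB_eigenQuotient hg]
  exact h.factorc.apply_eq_zero fun j hj => h.coord_eigenQuotient i (hn.trans hj)

lemma det_ne_zero {n : ℕ} (hn : M ≤ n + 1) :
    (Matrix.of fun k i : Fin M => g (n + 1 - M + k) i).det ≠ 0 := by
  intro h0
  obtain ⟨c, hc, hTc⟩ := Matrix.exists_mulVec_eq_zero_iff.2 h0
  -- Here s bounds how far k lies below the window n + 1 - M, …, n of vanishing values.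
  have hvan : ∀ s k, n + 1 - M ≤ k + s → k ≤ n → ∑ i, g k i * c i = 0 := by
    intro s
    induction s with
    | zero =>
      intro k hk hkn
      have e := congrFun hTc ⟨k - (n + 1 - M), by omega⟩
      simp only [Matrix.mulVec, dotProduct, Matrix.of_apply, Pi.zero_apply] at e
      rwa [show n + 1 - M + (k - (n + 1 - M)) = k by omega] at e
    | succ s ih =>
      intro k hk hkn
      by_cases hks : n + 1 - M ≤ k + s
      · exact ih k hks hkn
      -- The recurrence of row k + M involves the indices k, …, k + M. All but k are already
      -- covered, and the coefficient at k is nonzero.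
      have e : ∑ l : Fin (M + 1), connection Sc S (k + M) (k + l) * ∑ i, g (k + l) i * c i = 0 := by
        simp only [Finset.mul_sum, ← mul_assoc]
        rw [Finset.sum_comm]
        refine Finset.sum_eq_zero fun i _ => ?_
        have e1 := h.sum_connection_mul_eq_zero hg (n := k + M) (by omega) i
        rw [Nat.add_sub_cancel] at e1
        rw [← Finset.sum_mul, e1, zero_mul]
      have e2 : ∀ l : Fin M, ∑ i, g (k + (l.succ : ℕ)) i * c i = 0 := fun l => by
        have hl := l.2
        rw [Fin.val_succ]
        exact ih _ (by omega) (by omega)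
      simp only [Fin.sum_univ_succ, e2, mul_zero, Finset.sum_const_zero, add_zero, Fin.val_zero] at e
      exact (mul_eq_zero.1 e).resolve_left (h.connection_add_ne_zero k)
  refine hc (h.spectral.eq_zero_of_sum_smul_eigenQuotient
    (h.normalized.det_ne_zero h.lt h.card) ?_)
  rw [h.factorc.eq_sum_polyA (n := M) (g := ∑ i, c i • G.eigenQuotient i) fun j hj => ?_]
  · refine Finset.sum_eq_zero fun m hm => ?_
    have e : G.perturbedPairing ℓ (polyB Sc m) (∑ i, c i • G.eigenQuotient i) =
        -∑ k ∈ Finset.range (m + 1), connection Sc S m k * ∑ i, g k i * c i := by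
      simp only [map_sum, map_smul, h.perturbedPairing_polyB_eigenQuotient hg, smul_eq_mul, mul_neg,
        Finset.mul_sum, Finset.sum_neg_distrib]
      rw [Finset.sum_comm]
      congr 1
      refine Finset.sum_congr rfl fun k _ => Finset.sum_congr rfl fun i _ => ?_
      ring
    rw [e, Finset.sum_eq_zero, neg_zero, zero_smul]
    intro k hk
    have h1 := Finset.mem_range.1 hk
    have h2 := Finset.mem_range.1 hm
    rw [hvan (n + 1 - M) k (by omega) (by omega), mul_zero]
  · rw [map_sum]
    exact Finset.sum_eq_zero fun i _ => by rw [map_smul, h.coord_eigenQuotient i hj, smul_zero]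

lemma connection_mul_det {n : ℕ} (hn : M ≤ n) (j : Fin (M + 1)) :
    connection Sc S n (n - j) * (Matrix.of fun k i : Fin M => g (n - M + k) i).det =
      (-1) ^ (j : ℕ) *
        (Matrix.of fun k i : Fin M => g (n - M + ((Fin.rev j).succAbove k : ℕ)) i).det := by
  have hj := j.2
  have e := coeff_eq_minor_of_sum_eq_zero (fun k : Fin (M + 1) => g (n - M + k))
    (fun k => connection Sc S n (n - M + k))
    (by rw [Fin.val_last, Nat.sub_add_cancel hn, connection_self h.factor.left h.factorc.left])
    (h.sum_connection_mul_eq_zero hg hn) (Fin.rev j)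
  have hrev : ((Fin.rev j : Fin (M + 1)) : ℕ) = M - j := by rw [Fin.val_rev]; omega
  -- Omitting row M - j gives the exponent (M - j) + M, of the same parity as j.
  have hsign : (-1 : ℂ) ^ (((Fin.rev j : Fin (M + 1)) : ℕ) + M) = (-1) ^ (j : ℕ) := by
    rw [hrev, show M - (j : ℕ) + M = j + 2 * (M - j) by omega, pow_add, pow_mul]
    simp
  rw [hsign, hrev, show n - M + (M - (j : ℕ)) = n - j by omega] at e
  exact e

lemma det_bordered {n : ℕ} (hn : M ≤ n) (b : Fin q) (x : ℂ) :
    (Matrix.of fun k : Fin (M + 1) =>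
      (Fin.snoc (fun i : Fin M => g (n - M + k) i) ((polyB S (n - M + k) b).eval x) :
        Fin (M + 1) → ℂ)).det =
      (polyB Sc n b).eval x * (Matrix.of fun k i : Fin M => g (n - M + k) i).det := by
  have e := det_bordered_of_sum_eq_zero (fun k : Fin (M + 1) => g (n - M + k))
    (fun k => (polyB S (n - M + k) b).eval x)
    (fun k => connection Sc S n (n - M + k))
    (by rw [Fin.val_last, Nat.sub_add_cancel hn, connection_self h.factor.left h.factorc.left])
    (h.sum_connection_mul_eq_zero hg hn)
  refine e.trans ?_
  congr 1
  rw [polyB_eq_sum_connection h.factor.left,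
    ← sum_range_window (f := fun k => connection Sc S n k * (polyB S k b).eval x) hn fun k hk => by
      rw [h.connection_eq_zero hk, zero_mul]]
  simp [Polynomial.eval_finsetSum]

/-- Both parts expand in the Ǎ_m, m ≤ n: R A_k for k ≤ n - M has coefficients Ω_{m,k}, and E_i has
coefficients -∑_k Ω_{m,k} g_k^{(i)}. Their sum leaves only k > n - M. -/
lemma eval_mulVec_kernel {n : ℕ} (hn : M ≤ n) (i : Fin M) (a : Fin p) {x : ℂ} (hx : x ≠ G.x i) :
    ∑ c, (G.R a c).eval x * (∑ k ∈ Finset.range (n - M + 1), (polyA Sbar H k c).eval x * g k i +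
        G.vR i c / (x - G.x i)) =
      -∑ k : Fin M, (∑ m ∈ Finset.range (n + 1), connection Sc S m (n + 1 - M + k) *
        (polyA Scbar Hc m a).eval x) * g (n + 1 - M + k) i := by
  have h1 : ∑ c, (G.R a c).eval x *
      ∑ k ∈ Finset.range (n - M + 1), (polyA Sbar H k c).eval x * g k i =
      ∑ k ∈ Finset.range (n - M + 1), (∑ m ∈ Finset.range (n + 1), connection Sc S m k *
        (polyA Scbar Hc m a).eval x) * g k i := by
    simp only [Finset.mul_sum, ← mul_assoc]
    rw [Finset.sum_comm]
    refine Finset.sum_congr rfl fun k hk => ?_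
    have e := congrArg (Polynomial.eval x) (congrFun (h.mulVec_polyA (n := n) (k := k)
      (by have := Finset.mem_range.1 hk; omega)) a)
    simp only [Matrix.mulVec, dotProduct, Polynomial.eval_finsetSum, Polynomial.eval_mul,
      Finset.sum_apply, Pi.smul_apply, Polynomial.eval_smul, smul_eq_mul] at e
    rw [← Finset.sum_mul, e]
  have h2 : ∑ c, (G.R a c).eval x * (G.vR i c / (x - G.x i)) =
      -∑ k ∈ Finset.range (n + 1), (∑ m ∈ Finset.range (n + 1), connection Sc S m k *
        (polyA Scbar Hc m a).eval x) * g k i := by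
    have e1 := congrArg (Polynomial.eval x) (h.spectral.X_sub_C_mul_eigenQuotient i a)
    simp only [Polynomial.eval_mul, Polynomial.eval_sub, Polynomial.eval_X, Polynomial.eval_C,
      Matrix.mulVec, dotProduct, Polynomial.eval_finsetSum] at e1
    have e2 : (G.eigenQuotient i a).eval x =
        ∑ c, (G.R a c).eval x * (G.vR i c / (x - G.x i)) := by
      simp only [← mul_div_assoc]
      rw [← Finset.sum_div, eq_div_iff (sub_ne_zero.2 hx), ← e1, mul_comm]
    have e3 := congrArg (Polynomial.eval x) (congrFun (h.factorc.eq_sum_polyA (n := n + 1)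
      fun j hj => h.coord_eigenQuotient i (j := j) (by omega)) a)
    simp only [Polynomial.eval_finsetSum, Finset.sum_apply, Pi.smul_apply, Polynomial.eval_smul,
      smul_eq_mul, h.perturbedPairing_polyB_eigenQuotient hg] at e3
    rw [← e2, e3]
    -- Ω_{m,k} = 0 for k > m, so every inner sum may run to n and the order of summation can be
    -- exchanged.
    have e4 : ∀ m ∈ Finset.range (n + 1), ∑ k ∈ Finset.range (m + 1), connection Sc S m k * g k i =
        ∑ k ∈ Finset.range (n + 1), connection Sc S m k * g k i := by
      intro m hm
      refine Finset.sum_subset (Finset.range_mono (by have := Finset.mem_range.1 hm; omega)) ?_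
      intro k _ hk
      rw [connection_of_lt (by simpa using hk), zero_mul]
    rw [Finset.sum_congr rfl fun m hm => by rw [e4 m hm]]
    simp only [neg_mul, Finset.sum_mul, Finset.sum_neg_distrib]
    rw [Finset.sum_comm]
    congr 1
    refine Finset.sum_congr rfl fun k _ => Finset.sum_congr rfl fun m _ => ?_
    ring
  have h3 : ∀ F : ℕ → ℂ, ∑ k ∈ Finset.range (n + 1), F k =
      ∑ k ∈ Finset.range (n - M + 1), F k + ∑ k : Fin M, F (n + 1 - M + k) := by
    intro F
    rw [show n + 1 = (n - M + 1) + M by omega, Finset.sum_range_add, Nat.add_sub_cancel,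
      ← Finset.sum_range fun k => F (n - M + 1 + k)]
  simp only [mul_add]
  rw [Finset.sum_add_distrib, h1, h2, h3, neg_add, add_neg_cancel_left]

/-- By linearity in the last row, the weights R_{a,c}(x) may be moved inside it. It becomes a
combination of g_{n-M+1}, …, g_n, of which only the g_n part survives. -/
lemma sum_eval_mul_det {n : ℕ} (hM : 0 < M) (hn : M ≤ n) (a : Fin p) {x : ℂ}
    (hx : ∀ i, x ≠ G.x i) :
    ∑ c, (G.R a c).eval x * (Matrix.of fun k i : Fin M =>
      if (k : ℕ) + 1 < M then g (n - M + 1 + k) i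
      else ∑ k ∈ Finset.range (n - M + 1), (polyA Sbar H k c).eval x * g k i +
        G.vR i c / (x - G.x i)).det =
      -((polyA Scbar Hc n a).eval x * (Matrix.of fun k i : Fin M => g (n + 1 - M + k) i).det) := by
  set T : Matrix (Fin M) (Fin M) ℂ := Matrix.of fun k i : Fin M => g (n + 1 - M + k) i with hT
  set j : Fin M := ⟨M - 1, by omega⟩ with hj
  have h1 : ∀ c, (Matrix.of fun k i : Fin M =>
      if (k : ℕ) + 1 < M then g (n - M + 1 + k) i
      else ∑ k ∈ Finset.range (n - M + 1), (polyA Sbar H k c).eval x * g k i +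
        G.vR i c / (x - G.x i)) = T.updateRow j fun i =>
        ∑ k ∈ Finset.range (n - M + 1), (polyA Sbar H k c).eval x * g k i +
          G.vR i c / (x - G.x i) := by
    intro c
    ext k i
    have hk := k.2
    rw [Matrix.updateRow_apply, Matrix.of_apply, hT, Matrix.of_apply,
      show n - M + 1 = n + 1 - M by omega]
    by_cases hkj : k = j
    · rw [if_pos hkj, if_neg (by rw [hkj]; simp only [hj]; omega)]
    · rw [if_neg hkj, if_pos]
      have : (k : ℕ) ≠ M - 1 := fun e => hkj (Fin.ext e)
      omega
  simp only [h1]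
  rw [← det_updateRow_sum_smul]
  have h2 : (∑ c, (G.R a c).eval x • fun i =>
      ∑ k ∈ Finset.range (n - M + 1), (polyA Sbar H k c).eval x * g k i +
          G.vR i c / (x - G.x i)) = ∑ k : Fin M, (-∑ m ∈ Finset.range (n + 1),
        connection Sc S m (n + 1 - M + k) * (polyA Scbar Hc m a).eval x) • T k := by
    funext i
    simp only [Finset.sum_apply, Pi.smul_apply, smul_eq_mul]
    rw [h.eval_mulVec_kernel hg hn i a (hx i), ← Finset.sum_neg_distrib]
    exact Finset.sum_congr rfl fun k _ => (neg_mul _ _).symm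
  -- The coefficient of the row g_n is -∑_{m ≤ n} Ω_{m,n} Ǎ_m, which is -Ǎ_n by unitriangularity.
  rw [h2, Matrix.det_updateRow_sum, show n + 1 - M + ((j : Fin M) : ℕ) = n by simp only [hj]; omega,
    Finset.sum_range_succ, Finset.sum_eq_zero, connection_self h.factor.left h.factorc.left]
  · simp
  · intro m hm
    rw [connection_of_lt (Finset.mem_range.1 hm), zero_mul]

end Connected

lemma KK_apply (G : GeronimusData p q M) (μ : Matrix (Fin q) (Fin p) (ComplexMeasure ℝ))
    (S Sbar : Matrix ℕ ℕ ℂ) (H : ℕ → ℂ) (n : ℕ) (i : Fin M) (x : ℂ) (c : Fin p) :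
    G.KK μ S Sbar H n i x c =
      ∑ k ∈ Finset.range (n + 1), (polyA Sbar H k c).eval x * G.DW μ S k i := by
  simp only [KK, DW, DD, WW, kernelD, kernel, Pi.sub_apply, Pi.smul_apply, Matrix.mulVec, dotProduct,
    mul_sub, Finset.sum_sub_distrib, Finset.mul_sum, Finset.sum_mul, smul_eq_mul]
  congr 1
  · rw [Finset.sum_comm]
    exact Finset.sum_congr rfl fun k _ => Finset.sum_congr rfl fun a _ => by ring
  · rw [Finset.sum_comm]
    exact Finset.sum_congr rfl fun k _ => Finset.sum_congr rfl fun a _ => by ring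

lemma tauMinor_last (G : GeronimusData p q M) (μ : Matrix (Fin q) (Fin p) (ComplexMeasure ℝ))
    (S : Matrix ℕ ℕ ℂ) {n : ℕ} (hn : M ≤ n) : G.tauMinor μ S n (Fin.last M) = G.tau μ S n := by
  refine congrArg Matrix.det (Matrix.ext fun k i => ?_)
  have e : n - M + (((Fin.rev (Fin.last M)).succAbove k : Fin (M + 1)) : ℕ) = n + 1 - M + k := by
    rw [Fin.rev_last, Fin.zero_succAbove, Fin.val_succ]
    omega
  rw [Matrix.of_apply, Matrix.of_apply, e]

lemma tau_pred (G : GeronimusData p q M) (μ : Matrix (Fin q) (Fin p) (ComplexMeasure ℝ))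
    (S : Matrix ℕ ℕ ℂ) {n : ℕ} (hn : 1 ≤ n) :
    (Matrix.of fun k i : Fin M => G.DW μ S (n - M + k) i).det = G.tau μ S (n - 1) := by
  rw [tau, Nat.sub_add_cancel hn]

end GeronimusData

end MixedMOP

end

/-! ### Assembly of the theorem -/

theorem mainTheorem1 {p q M : ℕ} [NeZero p] [NeZero q]
    (N r : ℕ) (hN : 1 ≤ N) (hr : r < p) (hM : M + r = N * p)
    (μ : Matrix (Fin q) (Fin p) (MeasureTheory.ComplexMeasure ℝ))
    (hμ : ∀ b a (k : ℕ), (μ b a).Integrable fun t : ℝ => (t : ℂ) ^ k)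
    (G : MixedMOP.GeronimusData p q M)
    (hR : MixedMOP.IsNormalized G.R N r) (hG : G.IsSpectral)
    (hΔ : ∀ i, ∀ t ∈ MixedMOP.supp μ, G.x i ≠ (t : ℂ))
    (S Sbar Sc Scbar : Matrix ℕ ℕ ℂ) (H Hc : ℕ → ℂ)
    (hLU : MixedMOP.GaussBorel (MixedMOP.momentMatrix (MixedMOP.integ μ)) S Sbar H)
    (hLUc : MixedMOP.GaussBorel (MixedMOP.momentMatrix (G.perturbed μ)) Sc Scbar Hc) :
    (∀ n, M ≤ n + 1 → G.tau μ S n ≠ 0) ∧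
    ∀ n, M ≤ n →
      MixedMOP.connection Sc S n (n - M) = (-1) ^ M * (G.tau μ S n / G.tau μ S (n - 1)) ∧
      (∀ j : Fin (M + 1), MixedMOP.connection Sc S n (n - j) =
        (-1) ^ (j : ℕ) * (G.tauMinor μ S n j / G.tau μ S (n - 1))) ∧
      (∀ (a : Fin p) (x : ℂ), (∀ i, x ≠ G.x i) →
        (MixedMOP.polyA Scbar Hc n a).eval x =
          -∑ c : Fin p, (G.R a c).eval x / G.tau μ S n * G.detA μ S Sbar H n c x) ∧
      (∀ (b : Fin q) (x : ℂ),
        (MixedMOP.polyB Sc n b).eval x = 1 / G.tau μ S (n - 1) * G.detB μ S n b x) := by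
  -- M ≥ 1 provides the last row of the determinant for Ǎ_n and gives n ≥ 1, so that n - 1 is not
  -- truncated.
  have hM0 : 0 < M := by
    have : 1 * p ≤ N * p := Nat.mul_le_mul_right p hN
    omega
  have hd : ∀ t ∈ MixedMOP.supp μ, G.R.det.eval (t : ℂ) ≠ 0 := by
    intro t ht h0
    obtain ⟨i, hi⟩ := hG.exists_eq_of_isRoot hR hr hM h0
    exact hΔ i t ht hi.symm
  rw [MixedMOP.momentMatrix_integ hμ hd] at hLU
  rw [MixedMOP.momentMatrix_perturbed hμ hd] at hLUc
  have h : G.Connected N r _ S Sbar Sc Scbar H Hc := ⟨hr, hM, hR, hG, hLU, hLUc⟩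
  have hg := hG.DW_eq hμ hd hΔ S
  have hτ : ∀ n, M ≤ n + 1 → G.tau μ S n ≠ 0 := fun n hn => h.det_ne_zero hg hn
  refine ⟨hτ, fun n hn => ?_⟩
  have hτ' : G.tau μ S (n - 1) ≠ 0 := hτ (n - 1) (by omega)
  have e' := G.tau_pred μ S (n := n) (by omega)
  have hΩ : ∀ j : Fin (M + 1), MixedMOP.connection Sc S n (n - j) =
      (-1) ^ (j : ℕ) * (G.tauMinor μ S n j / G.tau μ S (n - 1)) := by
    intro j
    have e := h.connection_mul_det hg hn j
    rw [e'] at e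
    rw [← mul_div_assoc, eq_div_iff hτ', e, MixedMOP.GeronimusData.tauMinor]
  refine ⟨?_, hΩ, fun a x hx => ?_, fun b x => ?_⟩
  · have e := G.tauMinor_last μ S hn
    have e2 := hΩ (Fin.last M)
    rwa [Fin.val_last, e] at e2
  · have e := h.sum_eval_mul_det hg hM0 hn a hx
    simp only [← MixedMOP.GeronimusData.KK_apply] at e
    simp only [div_mul_eq_mul_div]
    rw [← Finset.sum_div, eq_comm, neg_eq_iff_eq_neg, div_eq_iff (hτ n (by omega)), neg_mul]
    exact e
  · have e := h.det_bordered hg hn b x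
    rw [e'] at e
    rw [one_div, eq_inv_mul_iff_mul_eq₀ hτ', mul_comm]
    exact e.symm
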